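/- Let $F$ be a non-archimedean local field of characteristic zero and odd residual characteristic, with ring of integers $\mathfrak o_F$ and residue field of cardinality $q$, and let $E=F[\sqrt\epsilon]$ be its unramified quadratic extension, where $\epsilon\in\mathfrak o_F^\times$ is a non-square. Write $\mathfrak o_E$, $\mathfrak p_E$ for the ring of integers of $E$ and its maximal ideal, $|\cdot|_F$, $|\cdot|_E$ for the normalized absolute values, $x\mapsto\overline x$ for the non-trivial element of $\mathrm{Gal}(E/F)$, $E^1=\{x\in E^\times : x\overline x=1\}$, and $\omega_{E/F}$ for the non-trivial character of $F^\times$ that is trivial on $N_{E/F}(E^\times)$. Let $$G=\{g\in \mathrm{GL}_3(E) : {}^t\overline g J g=J\},\qquad J=\begin{pmatrix}0&0&1\\0&1&0\\1&0&0\end{pmatrix},$$ let $B$ be the subgroup of upper triangular elements of $G$, and for $n\ge 0$ let $$K_n=\begin{pmatrix}\mathfrak o_E&\mathfrak o_E&\mathfrak p_E^{-n}\\ \mathfrak p_E^n&1+\mathfrak p_E^n&\mathfrak o_E\\ \mathfrak p_E^n&\mathfrak p_E^n&\mathfrak o_E\end{pmatrix}\cap G .$$ Let $\mu_1$ be an unramified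 quasi-character of $E^\times$ (that is, $\mu_1$ is trivial on $\mathfrak o_E^\times$) and $\mu_2$ a character of $E^1$. Let $\pi=\mathrm{Ind}_B^G(\mu_1\otimes\mu_2)$ be the normalized parabolic induction: $G$ acts by right translation on the space $V$ of locally constant functions $f:G\to\mathbf C$ with $$f(bg)=\delta_B(b)^{1/2}\mu_1(b_{11})\mu_2(b_{22})f(g)\qquad(b\in B,\ g\in G),$$ where $b_{ij}$ are the entries of $b$ and $\delta_B(b)=|b_{11}|_E^2$ is the modulus character of $B$. For $n\ge0$ let $V(n)=V^{K_n}$ be the space of $K_n$-fixed vectors. Fix a Haar measure on $G$. Then $V(n)\ne\{0\}$ for some $n\ge 0$. Put $N_\pi=\min\{n\ge0 : V(n)\neq\{0\}\}$. The formula $$\theta' f=\frac1{\mathrm{vol}(K_{N_\pi+1}\cap K_{N_\pi})}\int_{K_{N_\pi+1}}\pi(k)f\,dk$$ defines a linear operator $\theta':V(N_\pi)\to V(N_\pi+1)$, and $\theta'$ is injective if and only if $\mu_1|_{F^\times}\neq\omega_{E/F}\,|\cdot|_F^{-1}$. -/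

import Mathlib

open ValuativeRel MeasureTheory

noncomputable section

namespace U21

/-! ### Local fields -/

section LocalField

variable (K : Type*) [Field K] [ValuativeRel K] [TopologicalSpace K]
  [IsNonarchimedeanLocalField K]

/-- The cardinality of the residue field of `K`. -/
def residueCard : ℕ := Nat.card 𝓀[K]

/-- The absolute value of `K`, normalized so that a uniformizer has absolute value `q⁻¹`,
where `q` is the cardinality of the residue field. (The order isomorphism of the value group
with `ℤᵐ⁰` is unique and sends the valuation of a uniformizer to `exp (-1)`.) -/
def normAbs (x : K) : ℝ :=
  let m := IsNonarchimedeanLocalField.valueGroupWithZeroIsoInt K (valuation K x)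
  if m = 0 then 0 else (residueCard K : ℝ) ^ (WithZero.log m)

/-- The fractional ideal `𝔭 ^ n` of `K`, for an integer `n`. -/
def primePow (n : ℤ) : Set K := {x | normAbs K x ≤ (residueCard K : ℝ) ^ (-n)}

variable {K} in
/-- A quasi-character of `Kˣ` is unramified if it is trivial on the units of the ring of
integers, that is, if its conductor is zero. -/
def IsUnramifiedChar (μ : Kˣ →ₜ* ℂˣ) : Prop := ∀ u : Kˣ, normAbs K (u : K) = 1 → μ u = 1

end LocalField

section Extension

variable (F E : Type*) [Field F] [Field E] [Algebra F E]

/-- `E = F[√ε]` for a non-square `ε` which is a unit of the ring of integers of `F`. (In odd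
residual characteristic this is the unramified quadratic extension of `F`.) -/
def IsUnramifiedQuadratic [ValuativeRel F] : Prop :=
  ∃ (ε : F) (s : E), valuation F ε = 1 ∧ ¬ IsSquare ε ∧ s ^ 2 = algebraMap F E ε ∧
    Algebra.adjoin F {s} = ⊤

open scoped Classical in
/-- The non-trivial character of `Fˣ` that is trivial on the norm group of `Eˣ`; as the norm group
of a quadratic extension of local fields has index two, it is `-1` off the norm group. -/
def omegaEF (x : Fˣ) : ℂ :=
  if ∃ y : E, Algebra.norm F y = (x : F) then 1 else -1

end Extension

/-! ### The unitary group and its subgroups -/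

section Group

variable {F E : Type*} [Field F] [Field E] [Algebra F E] (σ : E ≃ₐ[F] E)

/-- The matrix of the hermitian form. -/
def J (E : Type*) [Field E] : Matrix (Fin 3) (Fin 3) E := !![0, 0, 1; 0, 1, 0; 1, 0, 0]

/-- The conjugate transpose with respect to `σ`. -/
def conjT (g : Matrix (Fin 3) (Fin 3) E) : Matrix (Fin 3) (Fin 3) E := (g.map σ).transpose

theorem conjT_mul (g h : Matrix (Fin 3) (Fin 3) E) : conjT σ (g * h) = conjT σ h * conjT σ g := by
  simp [conjT, Matrix.map_mul, Matrix.transpose_mul]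

theorem conjT_one : conjT σ 1 = 1 := by
  simp [conjT, Matrix.map_one]

/-- The unitary group in three variables. -/
def G : Subgroup (GL (Fin 3) E) where
  carrier := {g | conjT σ g.1 * J E * g.1 = J E}
  one_mem' := by simp [conjT_one]
  mul_mem' := by
    intro g h hg hh
    simp only [Set.mem_ofPred_eq] at hg hh ⊢
    calc conjT σ (g * h).1 * J E * (g * h).1
        = conjT σ h.1 * (conjT σ g.1 * J E * g.1) * h.1 := by
          simp only [Units.val_mul, conjT_mul, Matrix.mul_assoc]
      _ = J E := by rw [hg, hh]
  inv_mem' := by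
    intro g hg
    simp only [Set.mem_ofPred_eq] at hg ⊢
    calc conjT σ (g⁻¹).1 * J E * (g⁻¹).1
        = conjT σ (g⁻¹).1 * (conjT σ g.1 * J E * g.1) * (g⁻¹).1 := by rw [hg]
      _ = conjT σ (g.1 * (g⁻¹).1) * J E * (g.1 * (g⁻¹).1) := by
          simp only [conjT_mul, Matrix.mul_assoc]
      _ = J E := by simp [conjT_one]

/-- The matrix of an element of `G`. -/
abbrev mat (g : G σ) : Matrix (Fin 3) (Fin 3) E := (g : GL (Fin 3) E).1

/-- The Borel subgroup of upper triangular elements of `G`. -/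
def B : Subgroup (G σ) where
  carrier := {g | (mat σ g).BlockTriangular id}
  one_mem' := Matrix.blockTriangular_one
  mul_mem' := fun hg hh => hg.mul hh
  inv_mem' := by
    intro g hg
    have := (g : GL (Fin 3) E).invertible
    have h := Matrix.blockTriangular_inv_of_blockTriangular (M := mat σ g) hg
    simpa [mat] using h

/-- The norm-one subgroup of `Eˣ`. -/
def E1 : Subgroup Eˣ where
  carrier := {x | (x : E) * σ x = 1}
  one_mem' := by simp
  mul_mem' := by
    intro x y hx hy
    simp only [Set.mem_ofPred_eq, Units.val_mul, map_mul] at *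
    rw [mul_mul_mul_comm, hx, hy, one_mul]
  inv_mem' := by
    intro x hx
    simp only [Set.mem_ofPred_eq, Units.val_inv_eq_inv_val, map_inv₀] at *
    rw [← mul_inv, hx, inv_one]

theorem B_diag_ne_zero (b : B σ) (i : Fin 3) : mat σ b i i ≠ 0 := by
  intro h
  have h1 : (mat σ b).det ≠ 0 := ((b : G σ) : GL (Fin 3) E).isUnit.map Matrix.detMonoidHom |>.ne_zero
  rw [Matrix.det_of_isUpperTriangular b.2] at h1
  exact h1 (Finset.prod_eq_zero (Finset.mem_univ i) h)

/-- The `(1,1)`-entry `a` of an element of `B`. -/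
def entryA (b : B σ) : Eˣ := Units.mk0 (mat σ b 0 0) (B_diag_ne_zero σ b 0)

/-- The `(2,2)`-entry of an element of `B`, which has norm one. -/
def entryB (b : B σ) : E1 σ :=
  ⟨Units.mk0 (mat σ b 1 1) (B_diag_ne_zero σ b 1), by
    have h : conjT σ (mat σ b) * J E * mat σ b = J E := (b : G σ).2
    have h21 : mat σ b 2 1 = 0 := b.2 (by decide)
    have h11 := congrFun (congrFun h 1) 1
    simp [conjT, J, Matrix.mul_apply, Fin.sum_univ_three, h21] at h11
    change mat σ b 1 1 * σ (mat σ b 1 1) = 1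
    rw [mul_comm]
    exact h11⟩

end Group

/-! ### Induced representations, newforms and the level raising operator -/

section Representation

variable {F E : Type*} [Field F] [Field E] [Algebra F E] [ValuativeRel E] [TopologicalSpace E]
  [IsNonarchimedeanLocalField E] (σ : E ≃ₐ[F] E)

instance : MeasurableSpace (G σ) := borel _

instance : BorelSpace (G σ) := ⟨rfl⟩

/-- The open compact subgroup `K_n` of `G`, as a set. -/
def K (n : ℕ) : Set (G σ) :=
  {g | mat σ g 0 0 ∈ primePow E 0 ∧ mat σ g 0 1 ∈ primePow E 0 ∧ mat σ g 0 2 ∈ primePow E (-n) ∧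
    mat σ g 1 0 ∈ primePow E n ∧ mat σ g 1 1 - 1 ∈ primePow E n ∧ mat σ g 1 2 ∈ primePow E 0 ∧
    mat σ g 2 0 ∈ primePow E n ∧ mat σ g 2 1 ∈ primePow E n ∧ mat σ g 2 2 ∈ primePow E 0}

/-- The modulus character of `B`, `δ_B(b) = |a|_E ^ 2` where `a` is the `(1,1)`-entry of `b`. -/
def deltaB (b : B σ) : ℝ := normAbs E (entryA σ b : E) ^ 2

variable (μ₁ : Eˣ →ₜ* ℂˣ) (μ₂ : E1 σ →ₜ* ℂˣ)

/-- The quasi-character `μ₁ ⊗ μ₂` of the diagonal torus, extended trivially to `B`. -/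
def muB (b : B σ) : ℂ := (μ₁ (entryA σ b) : ℂ) * (μ₂ (entryB σ b) : ℂ)

/-- The space of the normalized parabolic induction of `μ₁ ⊗ μ₂` from `B` to `G`. -/
def indSpace : Submodule ℂ (G σ → ℂ) where
  carrier := {f | IsLocallyConstant f ∧
    ∀ (b : B σ) (g : G σ), f (b * g) = (√(deltaB σ b) : ℂ) * muB σ μ₁ μ₂ b * f g}
  zero_mem' := ⟨IsLocallyConstant.const 0, by simp⟩
  add_mem' := by
    rintro f f' ⟨h, h'⟩ ⟨k, k'⟩
    exact ⟨h.add k, fun b g => by simp only [Pi.add_apply, h', k']; ring⟩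
  smul_mem' := by
    rintro c f ⟨h, h'⟩
    exact ⟨h.comp (fun z => c • z), fun b g => by
      simp only [Pi.smul_apply, smul_eq_mul, h']; ring⟩

/-- The normalized parabolic induction of `μ₁ ⊗ μ₂`: the group `G` acts by right translation. -/
def ind : Representation ℂ (G σ) (indSpace σ μ₁ μ₂) where
  toFun g :=
    { toFun := fun f => ⟨fun x => f.1 (x * g),
        f.2.1.comp_continuous (continuous_mul_const g), fun b x => by
          simp only [mul_assoc, f.2.2]⟩
      map_add' := fun _ _ => rfl
      map_smul' := fun _ _ => rfl }
  map_one' := by ext f; simp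
  map_mul' := fun g h => by ext f; simp [mul_assoc]

variable {σ} in
/-- The space `V(n)` of vectors fixed by `K_n` in a representation of `G`. -/
def fixedVectors {V : Type*} [AddCommGroup V] [Module ℂ V] (π : Representation ℂ (G σ) V)
    (n : ℕ) : Submodule ℂ V where
  carrier := {v | ∀ k ∈ K σ n, π k v = v}
  zero_mem' := by simp
  add_mem' := fun hv hw k hk => by rw [map_add, hv k hk, hw k hk]
  smul_mem' := fun c v hv k hk => by rw [map_smul, hv k hk]

variable {σ} in
/-- The conductor `N_π`, the least `n` with `V(n) ≠ 0`
(for a representation such that there is one). -/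
def conductor {V : Type*} [AddCommGroup V] [Module ℂ V] (π : Representation ℂ (G σ) V) : ℕ :=
  sInf {n | fixedVectors π n ≠ ⊥}

/-- The function `vol(K_{n+1} ∩ K_n)⁻¹ ∫_{K_{n+1}} π(k) f dk` on `G`, for `f` in the space of the
induced representation `π` and a Haar measure `ν` on `G`. -/
def theta (ν : Measure (G σ)) (n : ℕ) (f : indSpace σ μ₁ μ₂) (g : G σ) : ℂ :=
  (ν.real (K σ (n + 1) ∩ K σ n) : ℂ)⁻¹ *
    ∫ k in K σ (n + 1), (ind σ μ₁ μ₂ k f : G σ → ℂ) g ∂ν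

end Representation

end U21

end

/-! Write `N` for the conductor and `q_E = q ^ 2` for the residue cardinality of `E`. The proof
reduces to two facts about evaluation at the identity.

Evaluation `f ↦ f 1` is injective on `V(n)` for every `n ≤ N + 1` (`eq_zero_of_apply_one_eq_zero`).
A coset `B g` is determined by the last row of `g` up to a scalar, so every double coset of `B` and
`K_n` meets the lower unipotents `gammaElt x` with `|x|² ≤ q_E⁻ⁿ` (`exists_mul_last_row_eq`). If
`|x| ≤ q_E⁻ⁿ`, then `gammaElt x` lies in `K_n` and gives the identity double coset. For larger `x`,
if `f` does not vanish at `gammaElt x`, the elements of `B` conjugate into `K_n` by `gammaElt x`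
force `μ₂` to be trivial at a level `m ≤ n - 2` (`character_eq_one_of_apply_gammaElt_ne_zero`). A
character trivial at level `m` gives a non-zero vector in `V(m)` supported on `B K_m`
(`fixedVectors_ne_bot`), so `N ≤ m < N`, which is absurd.

On `V(N)` the averaging operator is a sum over the `q + 1` cosets of `K_{N+1} ∩ K_N` in `K_{N+1}`
(`theta_eq_sum`). The `q` unipotent representatives lie in `B` with trivial weight, and the
antidiagonal one is a diagonal element times an element of `K_N`. Hence the value at the identity is
multiplied by `q_E μ₁(ϖ)⁻¹ + q` (`sum_apply_cosetRep`).

Since `V(N) ≠ 0` and evaluation is injective on both `V(N)` and `V(N + 1)`, the operator is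
injective exactly when this factor is non-zero. The factor vanishes iff `μ₁(ϖ) = -q`. For unramified
`μ₁` this is the exceptional condition, because `ω_{E/F}` is `-1` to the power of the valuation
(`restrict_eq_omega_iff`). -/

noncomputable section

namespace U21

/-! ### Normalized absolute value of a local field -/

section LocalField

variable {K : Type*} [Field K] [ValuativeRel K] [TopologicalSpace K]
  [IsNonarchimedeanLocalField K]

open WithZero

theorem one_lt_residueCard : 1 < residueCard K := Finite.one_lt_card

theorem one_lt_residueCard_real : (1 : ℝ) < residueCard K := by
  exact_mod_cast one_lt_residueCard (K := K)

theorem residueCard_pos : (0 : ℝ) < residueCard K := one_pos.trans one_lt_residueCard_real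

theorem normAbs_eq_of_valuation {x : K} {m : ℤ}
    (h : IsNonarchimedeanLocalField.valueGroupWithZeroIsoInt K (valuation K x) = exp m) :
    normAbs K x = (residueCard K : ℝ) ^ m := by
  simp [normAbs, h]

@[simp] theorem normAbs_zero : normAbs K 0 = 0 := by simp [normAbs]

theorem exists_valuation_eq_exp {x : K} (hx : x ≠ 0) : ∃ m : ℤ,
    IsNonarchimedeanLocalField.valueGroupWithZeroIsoInt K (valuation K x) = exp m :=
  ⟨_, (exp_log (by simpa using hx)).symm⟩

theorem exists_normAbs_eq_zpow {x : K} (hx : x ≠ 0) :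
    ∃ m : ℤ, normAbs K x = (residueCard K : ℝ) ^ m :=
  (exists_valuation_eq_exp hx).imp fun _ => normAbs_eq_of_valuation

theorem normAbs_pos {x : K} (hx : x ≠ 0) : 0 < normAbs K x := by
  obtain ⟨m, hm⟩ := exists_normAbs_eq_zpow hx
  rw [hm]
  exact zpow_pos residueCard_pos m

theorem normAbs_nonneg (x : K) : 0 ≤ normAbs K x := by
  rcases eq_or_ne x 0 with rfl | hx
  · simp
  · exact (normAbs_pos hx).le

@[simp] theorem normAbs_eq_zero {x : K} : normAbs K x = 0 ↔ x = 0 :=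
  ⟨fun h => by_contra fun hx => (normAbs_pos hx).ne' h, by rintro rfl; simp⟩

theorem normAbs_le_iff {x y : K} : normAbs K x ≤ normAbs K y ↔ valuation K x ≤ valuation K y := by
  rcases eq_or_ne x 0 with rfl | hx
  · simp [normAbs_nonneg]
  rcases eq_or_ne y 0 with rfl | hy
  · simp [(normAbs_nonneg x).ge_iff_eq']
  obtain ⟨m, hm⟩ := exists_valuation_eq_exp hx
  obtain ⟨k, hk⟩ := exists_valuation_eq_exp hy
  rw [normAbs_eq_of_valuation hm, normAbs_eq_of_valuation hk,
    zpow_le_zpow_iff_right₀ one_lt_residueCard_real,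
    ← map_le_map_iff (IsNonarchimedeanLocalField.valueGroupWithZeroIsoInt K), hm, hk, exp_le_exp]

theorem normAbs_lt_iff {x y : K} : normAbs K x < normAbs K y ↔ valuation K x < valuation K y := by
  rw [← not_le, ← not_le, normAbs_le_iff]

@[simp] theorem normAbs_one : normAbs K 1 = 1 := by
  rw [normAbs_eq_of_valuation (m := 0) (by simp)]
  simp

@[simp] theorem normAbs_mul (x y : K) : normAbs K (x * y) = normAbs K x * normAbs K y := by
  rcases eq_or_ne x 0 with rfl | hx
  · simp
  rcases eq_or_ne y 0 with rfl | hy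
  · simp
  obtain ⟨m, hm⟩ := exists_valuation_eq_exp hx
  obtain ⟨k, hk⟩ := exists_valuation_eq_exp hy
  rw [normAbs_eq_of_valuation hm, normAbs_eq_of_valuation hk,
    ← zpow_add₀ residueCard_pos.ne']
  exact normAbs_eq_of_valuation (by rw [map_mul, map_mul, hm, hk, exp_add])

variable (K) in
/-- The normalized absolute value as a homomorphism. -/
def normAbsHom : K →*₀ ℝ where
  toFun := normAbs K
  map_zero' := normAbs_zero
  map_one' := normAbs_one
  map_mul' := normAbs_mul

@[simp] theorem normAbs_inv (x : K) : normAbs K x⁻¹ = (normAbs K x)⁻¹ :=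
  map_inv₀ (normAbsHom K) x

@[simp] theorem normAbs_div (x y : K) : normAbs K (x / y) = normAbs K x / normAbs K y :=
  map_div₀ (normAbsHom K) x y

@[simp] theorem normAbs_pow (x : K) (n : ℕ) : normAbs K (x ^ n) = normAbs K x ^ n :=
  map_pow (normAbsHom K) x n

@[simp] theorem normAbs_zpow (x : K) (n : ℤ) : normAbs K (x ^ n) = normAbs K x ^ n :=
  map_zpow₀ (normAbsHom K) x n

@[simp] theorem normAbs_neg (x : K) : normAbs K (-x) = normAbs K x :=
  le_antisymm (by rw [normAbs_le_iff, Valuation.map_neg])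
    (by rw [normAbs_le_iff, Valuation.map_neg])

theorem normAbs_sub_comm (x y : K) : normAbs K (x - y) = normAbs K (y - x) := by
  rw [← normAbs_neg, neg_sub]

theorem normAbs_add_le {x y : K} {r : ℝ} (hx : normAbs K x ≤ r) (hy : normAbs K y ≤ r) :
    normAbs K (x + y) ≤ r := by
  rcases (valuation K).map_add' x y with h | h
  · exact (normAbs_le_iff.2 h).trans hx
  · exact (normAbs_le_iff.2 h).trans hy

theorem normAbs_sub_le {x y : K} {r : ℝ} (hx : normAbs K x ≤ r) (hy : normAbs K y ≤ r) :
    normAbs K (x - y) ≤ r := by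
  rw [sub_eq_add_neg]
  exact normAbs_add_le hx (by simpa using hy)

theorem normAbs_add_lt {x y : K} {r : ℝ} (hx : normAbs K x < r) (hy : normAbs K y < r) :
    normAbs K (x + y) < r :=
  (normAbs_add_le (le_max_left _ (normAbs K y)) (le_max_right (normAbs K x) _)).trans_lt
    (max_lt hx hy)

theorem normAbs_sub_lt {x y : K} {r : ℝ} (hx : normAbs K x < r) (hy : normAbs K y < r) :
    normAbs K (x - y) < r := by
  rw [sub_eq_add_neg]
  exact normAbs_add_lt hx (by simpa using hy)

theorem normAbs_add_eq_left {x y : K} (h : normAbs K y < normAbs K x) :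
    normAbs K (x + y) = normAbs K x := by
  refine le_antisymm (normAbs_add_le le_rfl h.le) (not_lt.1 fun h' => ?_)
  have := normAbs_sub_lt h' h
  simp at this

variable (K) in
theorem exists_normAbs_eq_inv : ∃ ϖ : K, normAbs K ϖ = (residueCard K : ℝ)⁻¹ := by
  obtain ⟨x, hx⟩ := valuation_surjective
    ((IsNonarchimedeanLocalField.valueGroupWithZeroIsoInt K).symm (exp (-1)))
  exact ⟨x, by rw [normAbs_eq_of_valuation (m := -1) (by simp [hx])]; simp⟩

theorem mem_primePow {n : ℤ} {x : K} :
    x ∈ primePow K n ↔ normAbs K x ≤ (residueCard K : ℝ) ^ (-n) := Iff.rfl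

theorem normAbs_le_one_iff {x : K} : normAbs K x ≤ 1 ↔ valuation K x ≤ 1 := by
  rw [← normAbs_one (K := K), normAbs_le_iff, map_one]

theorem normAbs_lt_one_iff {x : K} : normAbs K x < 1 ↔ valuation K x < 1 := by
  rw [← normAbs_one (K := K), normAbs_lt_iff, map_one]

theorem normAbs_eq_one_iff {x : K} : normAbs K x = 1 ↔ valuation K x = 1 := by
  rw [le_antisymm_iff, le_antisymm_iff (a := valuation K x), normAbs_le_one_iff,
    ← not_lt (a := normAbs K x), normAbs_lt_one_iff, not_lt]

theorem normAbs_lt_one_iff_le_inv {x : K} :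
    normAbs K x < 1 ↔ normAbs K x ≤ (residueCard K : ℝ)⁻¹ := by
  refine ⟨fun h => ?_, fun h => h.trans_lt (inv_lt_one_of_one_lt₀ one_lt_residueCard_real)⟩
  rcases eq_or_ne x 0 with rfl | hx
  · simp
  obtain ⟨m, hm⟩ := exists_normAbs_eq_zpow hx
  rw [hm] at h ⊢
  rw [zpow_lt_one_iff_right₀ one_lt_residueCard_real] at h
  rw [← zpow_neg_one, zpow_le_zpow_iff_right₀ one_lt_residueCard_real]
  omega

theorem exists_primePow_subset {U : Set K} (hU : U ∈ nhds (0 : K)) :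
    ∃ n : ℕ, primePow K n ⊆ U := by
  obtain ⟨γ, hγ, h⟩ := (IsValuativeTopology.hasBasis_nhds_zero' K).mem_iff.mp hU
  obtain ⟨y, rfl⟩ := valuation_surjective γ
  have hy : y ≠ 0 := by simpa using hγ
  obtain ⟨m, hm⟩ := exists_normAbs_eq_zpow hy
  -- The basic neighbourhood is an open ball, so the exponent exceeds `-m` by one to make the
  -- inequality strict.
  refine ⟨(1 - m).toNat, fun x hx => h ?_⟩
  change valuation K x < valuation K y
  rw [← normAbs_lt_iff, hm]
  refine lt_of_le_of_lt hx ?_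
  rw [zpow_lt_zpow_iff_right₀ one_lt_residueCard_real]
  omega

theorem exists_normAbs_eq (n : ℤ) : ∃ x : K, x ≠ 0 ∧ normAbs K x = (residueCard K : ℝ) ^ n := by
  obtain ⟨ϖ, h⟩ := exists_normAbs_eq_inv K
  have h1 : normAbs K (ϖ ^ (-n)) = (residueCard K : ℝ) ^ n := by simp [h]
  refine ⟨_, fun h0 => ?_, h1⟩
  rw [h0, normAbs_zero] at h1
  exact (zpow_pos residueCard_pos n).ne h1

theorem primePow_mem_nhds (n : ℤ) : primePow K n ∈ nhds (0 : K) := by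
  obtain ⟨y, hy, h⟩ := exists_normAbs_eq (K := K) (-n)
  refine (IsValuativeTopology.hasBasis_nhds_zero' K).mem_iff.mpr
    ⟨valuation K y, by simpa using hy, fun x hx => ?_⟩
  rw [mem_primePow, ← h]
  exact (normAbs_lt_iff.2 hx).le

theorem isCompact_primePow (n : ℤ) : IsCompact (primePow K n) := by
  obtain ⟨y, hy, h⟩ := exists_normAbs_eq (K := K) (-n)
  convert IsNonarchimedeanLocalField.isCompact_closedBall K (valuation K y) using 1
  ext x
  rw [mem_primePow, ← h]
  exact normAbs_le_iff

theorem isOpen_primePow (n : ℤ) : IsOpen (primePow K n) := by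
  rw [isOpen_iff_mem_nhds]
  intro x hx
  have h : (fun y => y - x) ⁻¹' primePow K n ∈ nhds x :=
    (continuous_id.sub continuous_const).continuousAt.preimage_mem_nhds
      (by simpa using primePow_mem_nhds n)
  refine Filter.mem_of_superset h fun y hy => ?_
  have := normAbs_add_le hx hy
  rwa [add_sub_cancel] at this

theorem mem_maximalIdeal_iff {x : 𝒪[K]} : x ∈ 𝓂[K] ↔ normAbs K (x : K) < 1 := by
  rw [IsLocalRing.mem_maximalIdeal, mem_nonunits_iff,
    Valuation.Integer.not_isUnit_iff_valuation_lt_one, normAbs_lt_one_iff]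

theorem residue_eq_zero_iff {x : 𝒪[K]} :
    IsLocalRing.residue 𝒪[K] x = 0 ↔ normAbs K (x : K) < 1 := by
  rw [IsLocalRing.residue_eq_zero_iff, mem_maximalIdeal_iff]

theorem normAbs_two (hK : ringChar 𝓀[K] ≠ 2) : normAbs K 2 = 1 := by
  have h2 : (2 : 𝓀[K]) ≠ 0 := Ring.two_ne_zero hK
  have h1 : valuation K (2 : K) ≤ 1 := (2 : 𝒪[K]).2
  refine le_antisymm (normAbs_le_one_iff.2 h1) (not_lt.1 fun h => h2 ?_)
  rw [← map_ofNat (IsLocalRing.residue 𝒪[K]) 2, residue_eq_zero_iff]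
  exact h

open Polynomial in
/-- Units congruent to one modulo the maximal ideal are squares, in odd residual characteristic. -/
theorem isSquare_of_normAbs_sub_one_lt (hK : ringChar 𝓀[K] ≠ 2) {x : K}
    (hx : normAbs K (x - 1) < 1) : IsSquare x := by
  let := IsTopologicalAddGroup.rightUniformSpace K
  have := isUniformAddGroup_of_addCommGroup (G := K)
  have hx1 : valuation K x ≤ 1 := by
    rw [← normAbs_le_one_iff, ← sub_add_cancel x 1]
    exact normAbs_add_le hx.le normAbs_one.le
  let y : 𝒪[K] := ⟨x, hx1⟩
  obtain ⟨a, ha, -⟩ := HenselianRing.is_henselian (I := 𝓂[K]) (X ^ 2 - C y)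
    (monic_X_pow_sub_C y two_ne_zero) 1
    (by
      rw [mem_maximalIdeal_iff, normAbs_sub_comm] at *
      simpa [y, normAbs_sub_comm] using hx)
    (by
      refine IsUnit.map _ ?_
      by_contra h
      rw [Valuation.Integer.not_isUnit_iff_valuation_lt_one, ← normAbs_lt_one_iff] at h
      have h2 := normAbs_two hK
      rw [← one_add_one_eq_two] at h2
      simp [h2] at h)
  refine ⟨a, ?_⟩
  have h : a ^ 2 - y = 0 := by simpa using ha
  rw [← sq]
  exact (congrArg Subtype.val (sub_eq_zero.1 h)).symm

end LocalField

/-! ### Arithmetic of the unramified quadratic extension -/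

section UnramifiedExtension

variable {F E : Type*}
    [Field F] [ValuativeRel F] [TopologicalSpace F] [IsNonarchimedeanLocalField F]
    [Field E] [ValuativeRel E] [TopologicalSpace E] [IsNonarchimedeanLocalField E]
    [Algebra F E]

theorem normAbs_algebraMap_le_iff [ValuativeExtension F E] {x y : F} :
    normAbs E (algebraMap F E x) ≤ normAbs E (algebraMap F E y) ↔ normAbs F x ≤ normAbs F y := by
  rw [normAbs_le_iff, normAbs_le_iff, ← Valuation.Compatible.vle_iff_le,
    ← Valuation.Compatible.vle_iff_le, ValuativeExtension.vle_iff_vle]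

theorem normAbs_algebraMap_lt_iff [ValuativeExtension F E] {x y : F} :
    normAbs E (algebraMap F E x) < normAbs E (algebraMap F E y) ↔ normAbs F x < normAbs F y := by
  rw [← not_le, ← not_le, normAbs_algebraMap_le_iff]

theorem normAbs_algebraMap_le_one_iff [ValuativeExtension F E] {x : F} :
    normAbs E (algebraMap F E x) ≤ 1 ↔ normAbs F x ≤ 1 := by
  simpa using normAbs_algebraMap_le_iff (E := E) (x := x) (y := 1)

theorem normAbs_algebraMap_lt_one_iff [ValuativeExtension F E] {x : F} :
    normAbs E (algebraMap F E x) < 1 ↔ normAbs F x < 1 := by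
  simpa using normAbs_algebraMap_lt_iff (E := E) (x := x) (y := 1)

theorem normAbs_algebraMap_eq_one_iff [ValuativeExtension F E] {x : F} :
    normAbs E (algebraMap F E x) = 1 ↔ normAbs F x = 1 := by
  rw [le_antisymm_iff, normAbs_algebraMap_le_one_iff, ← not_lt (b := (1 : ℝ)),
    normAbs_algebraMap_lt_one_iff, not_lt, ← le_antisymm_iff]

theorem exists_eq_add_mul {F E : Type*} [Field F] [Field E] [Algebra F E] {ε : F} {s : E}
    (hs : s ^ 2 = algebraMap F E ε) (hadj : Algebra.adjoin F {s} = ⊤) (x : E) :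
    ∃ a b : F, x = algebraMap F E a + algebraMap F E b * s := by
  have hx : x ∈ Algebra.adjoin F {s} := hadj ▸ Algebra.mem_top
  induction hx using Algebra.adjoin_induction with
  | mem x hx => exact ⟨0, 1, by simpa using hx⟩
  | algebraMap r => exact ⟨r, 0, by simp⟩
  | add x y _ _ hx hy =>
    obtain ⟨a, b, rfl⟩ := hx
    obtain ⟨c, d, rfl⟩ := hy
    exact ⟨a + c, b + d, by simp only [map_add]; ring⟩
  | mul x y _ _ hx hy =>
    obtain ⟨a, b, rfl⟩ := hx
    obtain ⟨c, d, rfl⟩ := hy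
    exact ⟨a * c + b * d * ε, a * d + b * c, by
      simp only [map_add, map_mul, ← hs]; ring⟩

theorem map_generator_eq_neg {F E : Type*} [Field F] [Field E] [Algebra F E] {ε : F} {s : E}
    (hs : s ^ 2 = algebraMap F E ε) (hadj : Algebra.adjoin F {s} = ⊤)
    {σ : E ≃ₐ[F] E} (hσ : σ ≠ 1) : σ s = -s := by
  have h : σ s ^ 2 = s ^ 2 := by rw [← map_pow, hs, AlgEquiv.commutes]
  refine (sq_eq_sq_iff_eq_or_eq_neg.1 h).resolve_left fun h => hσ ?_
  ext x
  obtain ⟨a, b, rfl⟩ := exists_eq_add_mul hs hadj x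
  simp [h]

theorem map_map_of_quadratic {F E : Type*} [Field F] [Field E] [Algebra F E] {ε : F} {s : E}
    (hs : s ^ 2 = algebraMap F E ε) (hadj : Algebra.adjoin F {s} = ⊤)
    {σ : E ≃ₐ[F] E} (hσ : σ ≠ 1) (x : E) : σ (σ x) = x := by
  obtain ⟨a, b, rfl⟩ := exists_eq_add_mul hs hadj x
  simp [map_generator_eq_neg hs hadj hσ]

theorem linearIndependent_one_generator {F E : Type*} [Field F] [Field E] [Algebra F E] {ε : F}
    {s : E} (hs : s ^ 2 = algebraMap F E ε) (hsq : ¬ IsSquare ε) :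
    LinearIndependent F ![1, s] := by
  rw [LinearIndependent.pair_iff]
  intro a b h
  have hb : b = 0 := by
    by_contra hb
    refine hsq ⟨a / b, (algebraMap F E).injective ?_⟩
    rw [← hs]
    have hb' : algebraMap F E b ≠ 0 := by simpa using hb
    have : s = -(algebraMap F E (a / b)) := by
      rw [Algebra.smul_def, Algebra.smul_def] at h
      rw [map_div₀]
      field_simp
      linear_combination h
    rw [this, map_mul]
    ring
  subst hb
  simpa using h

theorem algebraMap_norm_eq {F E : Type*} [Field F] [CharZero F] [Field E] [Algebra F E] {ε : F}
    {s : E} (hs : s ^ 2 = algebraMap F E ε) (hsq : ¬ IsSquare ε)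
    (hadj : Algebra.adjoin F {s} = ⊤) {σ : E ≃ₐ[F] E} (hσ : σ ≠ 1) (x : E) :
    algebraMap F E (Algebra.norm F x) = x * σ x := by
  classical
  have hspan : ⊤ ≤ Submodule.span F (Set.range ![1, s]) := by
    intro x _
    obtain ⟨a, b, rfl⟩ := exists_eq_add_mul hs hadj x
    rw [Matrix.range_cons, Matrix.range_cons, Matrix.range_empty, Set.union_empty,
      Set.singleton_union, Submodule.mem_span_pair]
    exact ⟨a, b, by simp [Algebra.smul_def]⟩
  have hrank : Module.finrank F E = 2 := by
    rw [Module.finrank_eq_card_basis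
      (Module.Basis.mk (linearIndependent_one_generator hs hsq) hspan)]
    simp
  have : Algebra.IsQuadraticExtension F E := { finrank_eq_two' := hrank }
  have hcard : Fintype.card Gal(E/F) = 2 := by
    rw [← Nat.card_eq_fintype_card, IsGalois.card_aut_eq_finrank, hrank]
  have huniv : (Finset.univ : Finset Gal(E/F)) = {1, σ} := by
    symm
    rw [← Finset.card_eq_iff_eq_univ, hcard, Finset.card_pair hσ.symm]
  rw [Algebra.norm_eq_prod_automorphisms, huniv, Finset.prod_pair hσ.symm]
  rfl

variable [ValuativeExtension F E] {ε : F} {s : E}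

theorem normAbs_generator (hε : valuation F ε = 1) (hs : s ^ 2 = algebraMap F E ε) :
    normAbs E s = 1 := by
  have h : normAbs E s ^ 2 = 1 := by
    rw [← normAbs_pow, hs, normAbs_algebraMap_eq_one_iff, normAbs_eq_one_iff, hε]
  exact (pow_eq_one_iff_of_nonneg (normAbs_nonneg s) two_ne_zero).1 h

/-- If `a + s` were not a unit, `a² - ε = (a + s)(a - s)` would be small. Then `ε / a²` would be
close to one, hence a square, and so would `ε`. -/
theorem normAbs_algebraMap_add_generator (hF : ringChar 𝓀[F] ≠ 2) (hε : valuation F ε = 1)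
    (hsq : ¬ IsSquare ε) (hs : s ^ 2 = algebraMap F E ε) {a : F} (ha : normAbs F a ≤ 1) :
    normAbs E (algebraMap F E a + s) = 1 := by
  have hs1 := normAbs_generator hε hs
  have ha' := (normAbs_algebraMap_le_one_iff (E := E)).2 ha
  refine le_antisymm (normAbs_add_le ha' hs1.le) (not_lt.1 fun h => hsq ?_)
  have h1 : normAbs E (algebraMap F E a - s) ≤ 1 := normAbs_sub_le ha' hs1.le
  have h2 : normAbs F (a ^ 2 - ε) < 1 := by
    rw [← normAbs_algebraMap_lt_one_iff (E := E), map_sub, map_pow, ← hs, sq_sub_sq, normAbs_mul]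
    exact mul_lt_one_of_nonneg_of_lt_one_left (normAbs_nonneg _) h h1
  rw [← normAbs_eq_one_iff] at hε
  have h3 : normAbs F (a ^ 2) = 1 := by
    rw [← hε, ← sub_add_cancel (a ^ 2) ε, add_comm]
    exact normAbs_add_eq_left (by rwa [hε])
  have ha0 : a ≠ 0 := by rintro rfl; simp at h3
  have h4 : IsSquare (ε / a ^ 2) := by
    refine isSquare_of_normAbs_sub_one_lt hF ?_
    rw [div_sub_one (pow_ne_zero 2 ha0), normAbs_div, h3, div_one, normAbs_sub_comm]
    exact h2
  have := h4.mul (IsSquare.sq a)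
  rwa [div_mul_cancel₀ _ (pow_ne_zero 2 ha0)] at this

/-- The basis `1, s` is orthonormal for the absolute value. Galois invariance, the residue degree
two and the absence of ramification are all read off from this. -/
theorem normAbs_add_mul_generator (hF : ringChar 𝓀[F] ≠ 2) (hε : valuation F ε = 1)
    (hsq : ¬ IsSquare ε) (hs : s ^ 2 = algebraMap F E ε) (a b : F) :
    normAbs E (algebraMap F E a + algebraMap F E b * s) =
      max (normAbs E (algebraMap F E a)) (normAbs E (algebraMap F E b)) := by
  have hs1 := normAbs_generator hε hs
  rcases lt_or_ge (normAbs E (algebraMap F E b)) (normAbs E (algebraMap F E a)) with h | h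
  · rw [max_eq_left h.le, normAbs_add_eq_left (by rwa [normAbs_mul, hs1, mul_one])]
  · rw [max_eq_right h]
    rcases eq_or_ne b 0 with rfl | hb
    · simpa [(normAbs_nonneg _).ge_iff_eq'] using h
    have hb' : algebraMap F E b ≠ 0 := by simpa using hb
    have h1 : normAbs F (a / b) ≤ 1 := by
      rw [normAbs_div, div_le_one (normAbs_pos hb)]
      exact normAbs_algebraMap_le_iff.1 h
    have h2 := normAbs_algebraMap_add_generator hF hε hsq hs h1
    have h3 : algebraMap F E a + algebraMap F E b * s =
        algebraMap F E b * (algebraMap F E (a / b) + s) := by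
      rw [map_div₀]
      field_simp
    rw [h3, normAbs_mul, h2, mul_one]

theorem normAbs_galois (hF : ringChar 𝓀[F] ≠ 2) (hε : valuation F ε = 1)
    (hsq : ¬ IsSquare ε) (hs : s ^ 2 = algebraMap F E ε) (hadj : Algebra.adjoin F {s} = ⊤)
    {σ : E ≃ₐ[F] E} (hσ : σ ≠ 1) (x : E) : normAbs E (σ x) = normAbs E x := by
  obtain ⟨a, b, rfl⟩ := exists_eq_add_mul hs hadj x
  have h := map_generator_eq_neg hs hadj hσ
  have h1 : σ (algebraMap F E a + algebraMap F E b * s) =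
      algebraMap F E a + algebraMap F E (-b) * s := by simp [h]
  rw [h1, normAbs_add_mul_generator hF hε hsq hs, normAbs_add_mul_generator hF hε hsq hs, map_neg,
    normAbs_neg]

theorem residueCard_eq_sq (hF : ringChar 𝓀[F] ≠ 2) (hε : valuation F ε = 1)
    (hsq : ¬ IsSquare ε) (hs : s ^ 2 = algebraMap F E ε) (hadj : Algebra.adjoin F {s} = ⊤) :
    residueCard E = residueCard F ^ 2 := by
  have hs1 := normAbs_generator hε hs
  let l : 𝓀[F] → 𝒪[F] := Function.surjInv IsLocalRing.residue_surjective
  have hl (r : 𝓀[F]) : IsLocalRing.residue 𝒪[F] (l r) = r := Function.surjInv_eq _ r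
  have hint (a b : 𝒪[F]) :
      algebraMap F E (a : F) + algebraMap F E (b : F) * s ∈ 𝒪[E] := by
    change valuation E _ ≤ 1
    rw [← normAbs_le_one_iff, normAbs_add_mul_generator hF hε hsq hs, max_le_iff,
      normAbs_algebraMap_le_one_iff, normAbs_algebraMap_le_one_iff, normAbs_le_one_iff,
      normAbs_le_one_iff]
    exact ⟨a.2, b.2⟩
  let φ : 𝓀[F] × 𝓀[F] → 𝓀[E] := fun p => IsLocalRing.residue 𝒪[E] ⟨_, hint (l p.1) (l p.2)⟩
  have hφ (a b : 𝒪[F]) (p : 𝓀[F] × 𝓀[F]) :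
      φ p = IsLocalRing.residue 𝒪[E] ⟨_, hint a b⟩ ↔
        p = (IsLocalRing.residue 𝒪[F] a, IsLocalRing.residue 𝒪[F] b) := by
    rw [← sub_eq_zero, ← map_sub, residue_eq_zero_iff]
    have h : ((⟨_, hint (l p.1) (l p.2)⟩ - ⟨_, hint a b⟩ : 𝒪[E]) : E) =
        algebraMap F E ((l p.1 - a : 𝒪[F]) : F) + algebraMap F E ((l p.2 - b : 𝒪[F]) : F) * s := by
      change (algebraMap F E (l p.1 : F) + algebraMap F E (l p.2 : F) * s) -
        (algebraMap F E (a : F) + algebraMap F E (b : F) * s) =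
        algebraMap F E ((l p.1 : F) - a) + algebraMap F E ((l p.2 : F) - b) * s
      simp only [map_sub]
      ring
    rw [h, normAbs_add_mul_generator hF hε hsq hs, max_lt_iff, normAbs_algebraMap_lt_one_iff,
      normAbs_algebraMap_lt_one_iff, ← residue_eq_zero_iff, ← residue_eq_zero_iff, map_sub,
      map_sub, hl, hl, sub_eq_zero, sub_eq_zero, Prod.ext_iff]
  have hbij : Function.Bijective φ := by
    constructor
    · intro p p' h
      have := (hφ (l p'.1) (l p'.2) p).1 h
      rwa [hl, hl] at this
    · intro r
      obtain ⟨⟨x, hx⟩, rfl⟩ := IsLocalRing.residue_surjective r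
      obtain ⟨a, b, rfl⟩ := exists_eq_add_mul hs hadj x
      have hx' : normAbs E (algebraMap F E a + algebraMap F E b * s) ≤ 1 :=
        normAbs_le_one_iff.2 hx
      rw [normAbs_add_mul_generator hF hε hsq hs, max_le_iff,
        normAbs_algebraMap_le_one_iff, normAbs_algebraMap_le_one_iff, normAbs_le_one_iff,
        normAbs_le_one_iff] at hx'
      exact ⟨_, (hφ ⟨a, hx'.1⟩ ⟨b, hx'.2⟩ _).2 rfl⟩
  rw [residueCard, residueCard, ← Nat.card_eq_of_bijective φ hbij, Nat.card_prod, sq]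

theorem normAbs_algebraMap_uniformizer (hF : ringChar 𝓀[F] ≠ 2) (hε : valuation F ε = 1)
    (hsq : ¬ IsSquare ε) (hs : s ^ 2 = algebraMap F E ε) (hadj : Algebra.adjoin F {s} = ⊤)
    {ϖ : F} (hϖ : normAbs F ϖ = (residueCard F : ℝ)⁻¹) :
    normAbs E (algebraMap F E ϖ) = (residueCard E : ℝ)⁻¹ := by
  refine le_antisymm ?_ ?_
  · rw [← normAbs_lt_one_iff_le_inv, normAbs_algebraMap_lt_one_iff, hϖ]
    exact inv_lt_one_of_one_lt₀ one_lt_residueCard_real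
  · obtain ⟨x, hx⟩ := exists_normAbs_eq_inv E
    obtain ⟨a, b, rfl⟩ := exists_eq_add_mul hs hadj x
    have key (c : F) (hc : normAbs E (algebraMap F E c) = (residueCard E : ℝ)⁻¹) :
        (residueCard E : ℝ)⁻¹ ≤ normAbs E (algebraMap F E ϖ) := by
      rw [← hc, normAbs_algebraMap_le_iff, hϖ, ← normAbs_lt_one_iff_le_inv,
        ← normAbs_algebraMap_lt_one_iff (E := E), hc]
      exact inv_lt_one_of_one_lt₀ one_lt_residueCard_real
    rw [normAbs_add_mul_generator hF hε hsq hs] at hx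
    rcases max_choice (normAbs E (algebraMap F E a)) (normAbs E (algebraMap F E b)) with h | h
    · exact key a (h ▸ hx)
    · exact key b (h ▸ hx)

theorem normAbs_algebraMap (hF : ringChar 𝓀[F] ≠ 2) (hε : valuation F ε = 1)
    (hsq : ¬ IsSquare ε) (hs : s ^ 2 = algebraMap F E ε) (hadj : Algebra.adjoin F {s} = ⊤)
    (x : F) : normAbs E (algebraMap F E x) = normAbs F x ^ 2 := by
  rcases eq_or_ne x 0 with rfl | hx
  · simp
  obtain ⟨ϖ, hϖ⟩ := exists_normAbs_eq_inv F
  obtain ⟨m, hm⟩ := exists_normAbs_eq_zpow hx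
  have h1 : normAbs F (x * ϖ ^ m) = 1 := by
    rw [normAbs_mul, hm, normAbs_zpow, hϖ, inv_zpow, mul_inv_cancel₀]
    exact (zpow_pos residueCard_pos m).ne'
  rw [← normAbs_algebraMap_eq_one_iff (E := E), map_mul, normAbs_mul, map_zpow₀, normAbs_zpow,
    normAbs_algebraMap_uniformizer hF hε hsq hs hadj hϖ, inv_zpow,
    mul_inv_eq_one₀ (zpow_pos residueCard_pos m).ne'] at h1
  rw [h1, hm, residueCard_eq_sq hF hε hsq hs hadj]
  push_cast
  rw [← zpow_natCast, ← zpow_natCast, ← zpow_mul, ← zpow_mul, mul_comm]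

-- Over the finite residue field the form `a² - ε b²` represents every element. This gives a norm
-- congruent to `u`, and the quotient is a square `c²`, itself the norm of `c`.
open Polynomial in
theorem exists_norm_eq_of_unit {F E : Type*} [Field F] [ValuativeRel F] [TopologicalSpace F]
    [IsNonarchimedeanLocalField F] [CharZero F] [Field E] [Algebra F E] {ε : F} {s : E}
    (hF : ringChar 𝓀[F] ≠ 2) (hε : valuation F ε = 1)
    (hsq : ¬ IsSquare ε) (hs : s ^ 2 = algebraMap F E ε) (hadj : Algebra.adjoin F {s} = ⊤)
    {σ : E ≃ₐ[F] E} (hσ : σ ≠ 1) {u : F} (hu : normAbs F u = 1) :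
    ∃ y : E, Algebra.norm F y = u := by
  have hnorm := algebraMap_norm_eq hs hsq hadj hσ
  have hσs := map_generator_eq_neg hs hadj hσ
  have hinj := (algebraMap F E).injective
  let ε' : 𝒪[F] := ⟨ε, hε.le⟩
  let u' : 𝒪[F] := ⟨u, normAbs_le_one_iff.1 hu.le⟩
  have hε' : IsLocalRing.residue 𝒪[F] ε' ≠ 0 := by
    rw [Ne, residue_eq_zero_iff, normAbs_lt_one_iff]
    exact hε.not_lt
  obtain ⟨a, b, hab⟩ : ∃ a b : 𝓀[F], a ^ 2 - IsLocalRing.residue 𝒪[F] ε' * b ^ 2 -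
      IsLocalRing.residue 𝒪[F] u' = 0 := by
    have := Fintype.ofFinite 𝓀[F]
    obtain ⟨a, b, hab⟩ := FiniteField.exists_root_sum_quadratic (R := 𝓀[F])
      (f := X ^ 2) (g := C (-IsLocalRing.residue 𝒪[F] ε') * X ^ 2 + C 0 * X +
        C (-IsLocalRing.residue 𝒪[F] u')) (degree_X_pow 2)
      (degree_quadratic (neg_ne_zero.2 hε')) (FiniteField.odd_card_of_char_ne_two hF)
    refine ⟨a, b, ?_⟩
    simp at hab
    linear_combination hab
  obtain ⟨a, rfl⟩ := IsLocalRing.residue_surjective a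
  obtain ⟨b, rfl⟩ := IsLocalRing.residue_surjective b
  rw [← map_pow, ← map_pow, ← map_mul, ← map_sub, ← map_sub, residue_eq_zero_iff] at hab
  change normAbs F ((a : F) ^ 2 - ε * (b : F) ^ 2 - u) < 1 at hab
  set y : E := algebraMap F E a + algebraMap F E b * s with hy
  have hn : Algebra.norm F y = (a : F) ^ 2 - ε * (b : F) ^ 2 := by
    apply hinj
    rw [hnorm, hy]
    simp only [map_add, map_mul, AlgEquiv.commutes, hσs, map_sub, map_pow, ← hs]
    ring
  rw [← hn] at hab
  have hn1 : normAbs F (Algebra.norm F y) = 1 := by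
    rw [← add_sub_cancel u (Algebra.norm F y), ← hu]
    exact normAbs_add_eq_left (by rwa [hu])
  have hn0 : Algebra.norm F y ≠ 0 := fun h => by simp [h] at hn1
  obtain ⟨c, hc⟩ : IsSquare (u / Algebra.norm F y) := by
    refine isSquare_of_normAbs_sub_one_lt hF ?_
    rwa [div_sub_one hn0, normAbs_div, hn1, div_one, normAbs_sub_comm]
  refine ⟨algebraMap F E c * y, hinj ?_⟩
  rw [hnorm, map_mul, AlgEquiv.commutes, mul_mul_mul_comm, ← hnorm, ← map_mul, ← hc, ← map_mul,
    div_mul_cancel₀ _ hn0]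

end UnramifiedExtension

/-! ### Explicit elements of the unitary group -/

section GroupElements

variable {F E : Type*} [Field F] [Field E] [Algebra F E] (σ : E ≃ₐ[F] E)

theorem J_mul_J : J E * J E = 1 := by
  ext i j
  fin_cases i <;> fin_cases j <;> simp [J, Matrix.mul_apply, Fin.sum_univ_three]

theorem mat_mul (g h : G σ) : mat σ (g * h) = mat σ g * mat σ h := rfl

@[simp] theorem mat_one : mat σ 1 = 1 := rfl

theorem mat_mul_apply (g h : G σ) (i j : Fin 3) : mat σ (g * h) i j =
    mat σ g i 0 * mat σ h 0 j + mat σ g i 1 * mat σ h 1 j + mat σ g i 2 * mat σ h 2 j := by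
  rw [mat_mul, Matrix.mul_apply, Fin.sum_univ_three]

theorem mat_injective : Function.Injective (mat σ) :=
  fun _ _ h => Subtype.ext (Units.ext h)

theorem mat_inv (g : G σ) : mat σ g⁻¹ = J E * conjT σ (mat σ g) * J E := by
  have h : conjT σ (mat σ g) * J E * mat σ g = J E := g.2
  have h1 : mat σ g * mat σ g⁻¹ = 1 := by rw [← mat_mul, mul_inv_cancel, mat_one]
  calc mat σ g⁻¹ = J E * (conjT σ (mat σ g) * J E * mat σ g) * mat σ g⁻¹ := by
        rw [h, J_mul_J, one_mul]
    _ = J E * conjT σ (mat σ g) * J E * (mat σ g * mat σ g⁻¹) := by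
        simp only [Matrix.mul_assoc]
    _ = _ := by rw [h1, mul_one]

theorem mat_inv_apply (g : G σ) (i j : Fin 3) : mat σ g⁻¹ i j = σ (mat σ g j.rev i.rev) := by
  rw [mat_inv]
  fin_cases i <;> fin_cases j <;>
    simp [J, conjT, Matrix.mul_apply, Fin.sum_univ_three, Fin.rev, -Matrix.cons_mul]

/-- The element of the unitary group given by a matrix preserving the hermitian form. -/
def ofMat (M : Matrix (Fin 3) (Fin 3) E) (h : conjT σ M * J E * M = J E) : G σ :=
  have h1 : J E * conjT σ M * J E * M = 1 := by
    rw [Matrix.mul_assoc, Matrix.mul_assoc, ← Matrix.mul_assoc (conjT σ M), h, J_mul_J]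
  ⟨⟨M, J E * conjT σ M * J E, mul_eq_one_comm.1 h1, h1⟩, h⟩

@[simp] theorem mat_ofMat (M : Matrix (Fin 3) (Fin 3) E) (h : conjT σ M * J E * M = J E) :
    mat σ (ofMat σ M h) = M := rfl

theorem isotropic_last_row (g : G σ) :
    mat σ g 2 0 * σ (mat σ g 2 2) + σ (mat σ g 2 0) * mat σ g 2 2
      + mat σ g 2 1 * σ (mat σ g 2 1) = 0 := by
  have h : mat σ (g * g⁻¹) 2 0 = 0 := by simp
  rw [mat_mul_apply, mat_inv_apply, mat_inv_apply, mat_inv_apply] at h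
  simp [Fin.rev] at h
  linear_combination h

theorem isotropic_last_col (g : G σ) :
    σ (mat σ g 0 2) * mat σ g 2 2 + σ (mat σ g 2 2) * mat σ g 0 2
      + σ (mat σ g 1 2) * mat σ g 1 2 = 0 := by
  have h : mat σ (g⁻¹ * g) 0 2 = 0 := by simp
  rw [mat_mul_apply, mat_inv_apply, mat_inv_apply, mat_inv_apply] at h
  simp [Fin.rev] at h
  linear_combination h

/-- The diagonal element with entries `(σ t)⁻¹, 1, t`. -/
def diagElt (hσσ : ∀ x, σ (σ x) = x) (t : E) (ht : t ≠ 0) : G σ :=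
  ofMat σ !![(σ t)⁻¹, 0, 0; 0, 1, 0; 0, 0, t] <| by
    ext i j
    fin_cases i <;> fin_cases j <;>
      simp [J, conjT, Matrix.mul_apply, Fin.sum_univ_three, hσσ, ht]

/-- The lower unipotent element with last row `(c, x, 1)`. -/
def lowerElt (hσσ : ∀ x, σ (σ x) = x) (x c : E) (h : c + σ c + x * σ x = 0) : G σ :=
  ofMat σ !![1, 0, 0; -σ x, 1, 0; c, x, 1] <| by
    ext i j
    fin_cases i <;> fin_cases j <;> simp [J, conjT, Matrix.mul_apply, Fin.sum_univ_three, hσσ]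
    linear_combination h

/-- The upper unipotent element with upper right entry `z`. -/
def upperElt (z : E) (h : z + σ z = 0) : G σ :=
  ofMat σ !![1, 0, z; 0, 1, 0; 0, 0, 1] <| by
    ext i j
    fin_cases i <;> fin_cases j <;> simp [J, conjT, Matrix.mul_apply, Fin.sum_univ_three]
    linear_combination h

/-- The antidiagonal element with entries `a⁻¹, 1, a`. -/
def antidiagElt (a : E) (ha : a ≠ 0) (h : σ a = a) : G σ :=
  ofMat σ !![0, 0, a⁻¹; 0, 1, 0; a, 0, 0] <| by
    ext i j
    fin_cases i <;> fin_cases j <;> simp [J, conjT, Matrix.mul_apply, Fin.sum_univ_three, h, ha]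

theorem mem_B_of_last_row {g : G σ} {t : E} (h0 : mat σ g 2 0 = 0) (h1 : mat σ g 2 1 = 0)
    (h2 : mat σ g 2 2 = t) : g ∈ B σ ∧ mat σ g 0 0 = (σ t)⁻¹ := by
  have h (i : Fin 3) : mat σ (g * g⁻¹) i 0 = mat σ g i 0 * σ t := by
    rw [mat_mul_apply, mat_inv_apply, mat_inv_apply, mat_inv_apply]
    simp [Fin.rev, h0, h1, h2]
  have h00 : mat σ g 0 0 * σ t = 1 := by simpa using (h 0).symm
  have h10 : mat σ g 1 0 = 0 := by
    have : mat σ g 1 0 * σ t = 0 := by simpa using (h 1).symm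
    exact (mul_eq_zero.1 this).resolve_right (right_ne_zero_of_mul_eq_one h00)
  refine ⟨fun i j hij => ?_, eq_inv_of_mul_eq_one_left h00⟩
  fin_cases i <;> fin_cases j <;> first | exact absurd hij (by decide) | assumption

/-- `B` is the stabilizer of the line spanned by the last basis row vector, so the line spanned by
the last row of `g` determines `B g`. -/
theorem mul_inv_mem_B_of_last_row {g g' : G σ} {t : E}
    (h : ∀ j, mat σ g' 2 j = t * mat σ g 2 j) :
    g' * g⁻¹ ∈ B σ ∧ mat σ (g' * g⁻¹) 0 0 = (σ t)⁻¹ ∧ mat σ (g' * g⁻¹) 2 2 = t := by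
  have h1 (j : Fin 3) : mat σ (g' * g⁻¹) 2 j = t * mat σ (g * g⁻¹) 2 j := by
    rw [mat_mul_apply, mat_mul_apply, h, h, h]
    ring
  have h2 : mat σ (g' * g⁻¹) 2 2 = t := by simp [h1]
  have h3 := mem_B_of_last_row σ (g := g' * g⁻¹) (by simp [h1]) (by simp [h1]) h2
  exact ⟨h3.1, h3.2, h2⟩

theorem last_row_ne_zero (g : G σ) : ∃ j, mat σ g 2 j ≠ 0 := by
  by_contra! h
  have : mat σ (g * g⁻¹) 2 2 = 0 := by rw [mat_mul_apply, h, h, h]; ring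
  simp at this

end GroupElements

/-! ### The groups `K_n` are compact and open -/

section CompactOpen

theorem continuous_mat {F E : Type*} [Field F] [Field E] [Algebra F E] [TopologicalSpace E]
    (σ : E ≃ₐ[F] E) : Continuous (mat σ) :=
  Units.continuous_val.comp continuous_subtype_val

variable {F E : Type*} [Field F] [Field E] [Algebra F E] [ValuativeRel E] [TopologicalSpace E]
  [IsNonarchimedeanLocalField E] (σ : E ≃ₐ[F] E)

theorem mem_K_iff {n : ℕ} {g : G σ} : g ∈ K σ n ↔
    normAbs E (mat σ g 0 0) ≤ 1 ∧ normAbs E (mat σ g 0 1) ≤ 1 ∧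
    normAbs E (mat σ g 0 2) ≤ (residueCard E : ℝ) ^ n ∧
    normAbs E (mat σ g 1 0) ≤ ((residueCard E : ℝ) ^ n)⁻¹ ∧
    normAbs E (mat σ g 1 1 - 1) ≤ ((residueCard E : ℝ) ^ n)⁻¹ ∧
    normAbs E (mat σ g 1 2) ≤ 1 ∧
    normAbs E (mat σ g 2 0) ≤ ((residueCard E : ℝ) ^ n)⁻¹ ∧
    normAbs E (mat σ g 2 1) ≤ ((residueCard E : ℝ) ^ n)⁻¹ ∧
    normAbs E (mat σ g 2 2) ≤ 1 := by
  simp [K, mem_primePow]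

theorem normAbs_mul_le {x y : E} {a b c : ℝ} (hx : normAbs E x ≤ a) (hy : normAbs E y ≤ b)
    (h : a * b ≤ c) : normAbs E (x * y) ≤ c := by
  rw [normAbs_mul]
  exact (mul_le_mul hx hy (normAbs_nonneg _) ((normAbs_nonneg _).trans hx)).trans h

theorem mul_mem_K {n : ℕ} {g h : G σ} (hg : g ∈ K σ n) (hh : h ∈ K σ n) : g * h ∈ K σ n := by
  rw [mem_K_iff] at *
  obtain ⟨a1, a2, a3, a4, a5, a6, a7, a8, a9⟩ := hg
  obtain ⟨b1, b2, b3, b4, b5, b6, b7, b8, b9⟩ := hh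
  set q : ℝ := (residueCard E : ℝ) ^ n
  have hq : 1 ≤ q := one_le_pow₀ one_lt_residueCard_real.le
  have hq0 : q ≠ 0 := (one_pos.trans_le hq).ne'
  have hq' : q⁻¹ ≤ 1 := inv_le_one_of_one_le₀ hq
  have hq1 : q⁻¹ * q⁻¹ ≤ q⁻¹ := mul_le_of_le_one_left (inv_nonneg.2 (by linarith)) hq'
  have h11 {x : E} (hx : normAbs E (x - 1) ≤ q⁻¹) : normAbs E x ≤ 1 := by
    rw [← sub_add_cancel x 1]
    exact normAbs_add_le (hx.trans hq') normAbs_one.le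
  have a5' := h11 a5
  have b5' := h11 b5
  have e : mat σ (g * h) 1 1 - 1 = mat σ g 1 0 * mat σ h 0 1 + (mat σ g 1 1 - 1) * mat σ h 1 1
      + (mat σ h 1 1 - 1) + mat σ g 1 2 * mat σ h 2 1 := by
    rw [mat_mul_apply]; ring
  rw [e]
  simp only [mat_mul_apply]
  refine ⟨?_, ?_, ?_, ?_, ?_, ?_, ?_, ?_, ?_⟩
  · exact normAbs_add_le (normAbs_add_le (normAbs_mul_le a1 b1 (by simp))
      (normAbs_mul_le a2 b4 (by simpa))) (normAbs_mul_le a3 b7 (by simp [hq0]))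
  · exact normAbs_add_le (normAbs_add_le (normAbs_mul_le a1 b2 (by simp))
      (normAbs_mul_le a2 b5' (by simp))) (normAbs_mul_le a3 b8 (by simp [hq0]))
  · exact normAbs_add_le (normAbs_add_le (normAbs_mul_le a1 b3 (by simp))
      (normAbs_mul_le a2 b6 (by simpa))) (normAbs_mul_le a3 b9 (by simp))
  · exact normAbs_add_le (normAbs_add_le (normAbs_mul_le a4 b1 (by simp))
      (normAbs_mul_le a5' b4 (by simp))) (normAbs_mul_le a6 b7 (by simp))
  · exact normAbs_add_le (normAbs_add_le (normAbs_add_le (normAbs_mul_le a4 b2 (by simp))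
      (normAbs_mul_le a5 b5' (by simp))) b5) (normAbs_mul_le a6 b8 (by simp))
  · exact normAbs_add_le (normAbs_add_le (normAbs_mul_le a4 b3 (by simp [hq0]))
      (normAbs_mul_le a5' b6 (by simp))) (normAbs_mul_le a6 b9 (by simp))
  · exact normAbs_add_le (normAbs_add_le (normAbs_mul_le a7 b1 (by simp))
      (normAbs_mul_le a8 b4 (by simpa))) (normAbs_mul_le a9 b7 (by simp))
  · exact normAbs_add_le (normAbs_add_le (normAbs_mul_le a7 b2 (by simp))
      (normAbs_mul_le a8 b5' (by simp))) (normAbs_mul_le a9 b8 (by simp))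
  · exact normAbs_add_le (normAbs_add_le (normAbs_mul_le a7 b3 (by simp [hq0]))
      (normAbs_mul_le a8 b6 (by simpa))) (normAbs_mul_le a9 b9 (by simp))

variable (hσn : ∀ x, normAbs E (σ x) = normAbs E x)
include hσn

theorem inv_mem_K {n : ℕ} {g : G σ} (hg : g ∈ K σ n) : g⁻¹ ∈ K σ n := by
  rw [mem_K_iff] at *
  obtain ⟨a1, a2, a3, a4, a5, a6, a7, a8, a9⟩ := hg
  have e : mat σ g⁻¹ 1 1 - 1 = σ (mat σ g 1 1 - 1) := by
    rw [mat_inv_apply, map_sub, map_one]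
    rfl
  rw [e]
  simp only [mat_inv_apply, hσn]
  exact ⟨a9, a6, a3, a8, a5, a2, a7, a4, a1⟩

/-- The set `K_n` as a subgroup. -/
def KSubgroup (n : ℕ) : Subgroup (G σ) where
  carrier := K σ n
  one_mem' := by
    have : (0 : ℝ) ≤ (residueCard E : ℝ) ^ n := by positivity
    simp [mem_K_iff, this]
  mul_mem' := mul_mem_K σ
  inv_mem' := inv_mem_K σ hσn

theorem one_mem_K (n : ℕ) : 1 ∈ K σ n := (KSubgroup σ hσn n).one_mem

theorem continuous_galois : Continuous σ := by
  refine continuous_of_continuousAt_zero σ.toLinearMap.toAddMonoidHom ?_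
  intro U hU
  obtain ⟨n, hn⟩ := exists_primePow_subset (K := E) (by simpa using hU)
  refine Filter.mem_map.2 (Filter.mem_of_superset (primePow_mem_nhds (n : ℤ)) fun x hx => hn ?_)
  change normAbs E (σ x) ≤ _
  rw [hσn]
  exact hx

omit hσn in
theorem isOpen_K (n : ℕ) : IsOpen (K σ n) := by
  have h (i j : Fin 3) : Continuous fun g : G σ => mat σ g i j :=
    (continuous_mat σ).matrix_elem i j
  have h' : Continuous fun g : G σ => mat σ g 1 1 - 1 := (h 1 1).sub continuous_const
  exact ((isOpen_primePow _).preimage (h 0 0)).inter <|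
    ((isOpen_primePow _).preimage (h 0 1)).inter <|
    ((isOpen_primePow _).preimage (h 0 2)).inter <|
    ((isOpen_primePow _).preimage (h 1 0)).inter <|
    ((isOpen_primePow _).preimage h').inter <|
    ((isOpen_primePow _).preimage (h 1 2)).inter <|
    ((isOpen_primePow _).preimage (h 2 0)).inter <|
    ((isOpen_primePow _).preimage (h 2 1)).inter <|
    ((isOpen_primePow _).preimage (h 2 2))

theorem isClosed_K (n : ℕ) : IsClosed (K σ n) :=
  (KSubgroup σ hσn n).isClosed_of_isOpen (isOpen_K σ n)

/-- Inversion in `G` is `J · conjT · J`, continuous in the entries alone. Hence the matrices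
preserving the form with entries in `𝔭⁻ⁿ` have compact image in `G`, and `K_n` is a closed subset of
this image. -/
theorem isCompact_K (n : ℕ) : IsCompact (K σ n) := by
  have hσc := continuous_galois σ hσn
  have hconj : Continuous fun m : Matrix (Fin 3) (Fin 3) E => conjT σ m :=
    (continuous_id.matrix_map hσc).matrix_transpose
  let C : Set (Matrix (Fin 3) (Fin 3) E) :=
    {m | conjT σ m * J E * m = J E} ∩ Set.univ.pi fun _ => Set.univ.pi fun _ => primePow E (-n)
  have : T2Space E := by
    let := IsTopologicalAddGroup.rightUniformSpace E
    have := isUniformAddGroup_of_addCommGroup (G := E)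
    infer_instance
  have : T2Space (Matrix (Fin 3) (Fin 3) E) := inferInstanceAs (T2Space (Fin 3 → Fin 3 → E))
  have hC : IsCompact C :=
    (isCompact_univ_pi fun _ => isCompact_univ_pi fun _ => isCompact_primePow _).inter_left
      (isClosed_eq ((hconj.matrix_mul continuous_const).matrix_mul continuous_id) continuous_const)
  have : CompactSpace C := isCompact_iff_compactSpace.1 hC
  let φ : C → G σ := fun m => ofMat σ m.1 m.2.1
  have hφ : Continuous φ := by
    refine Continuous.subtype_mk (Units.continuous_iff.2 ⟨continuous_subtype_val, ?_⟩) _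
    exact (continuous_const.matrix_mul (hconj.comp continuous_subtype_val)).matrix_mul
      continuous_const
  refine (isCompact_range hφ).of_isClosed_subset (isClosed_K σ hσn n) fun g hg => ?_
  have hq : (1 : ℝ) ≤ (residueCard E : ℝ) ^ n := one_le_pow₀ one_lt_residueCard_real.le
  have hq' := inv_le_one_of_one_le₀ hq
  refine ⟨⟨mat σ g, g.2, fun i _ j _ => ?_⟩, mat_injective σ rfl⟩
  rw [mem_primePow, neg_neg, zpow_natCast]
  rw [mem_K_iff] at hg
  obtain ⟨a1, a2, a3, a4, a5, a6, a7, a8, a9⟩ := hg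
  have a5' : normAbs E (mat σ g 1 1) ≤ 1 := by
    rw [← sub_add_cancel (mat σ g 1 1) 1]
    exact normAbs_add_le (a5.trans hq') normAbs_one.le
  fin_cases i <;> fin_cases j <;> simp <;> linarith

end CompactOpen

/-! ### Characters of `E¹`, the weight on `B` and existence of fixed vectors -/

/-- No small subgroups: while `w` stays near one, `w² - 1 = (w - 1)(w + 1)` with `‖w + 1‖ ≥ 3/2`, so
repeated squaring moves away from one geometrically. -/
theorem eq_one_of_norm_pow_sub_one_le {z : ℂ} (h : ∀ k : ℕ, ‖z ^ k - 1‖ ≤ 1 / 2) : z = 1 := by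
  have h1 (k : ℕ) : (3 / 2 : ℝ) ^ k * ‖z - 1‖ ≤ ‖z ^ 2 ^ k - 1‖ := by
    induction k with
    | zero => simp
    | succ k ih =>
      have h2 : ‖z ^ 2 ^ (k + 1) - 1‖ = ‖z ^ 2 ^ k - 1‖ * ‖z ^ 2 ^ k + 1‖ := by
        rw [← norm_mul, pow_succ 2, pow_mul]
        ring_nf
      have h3 : (3 / 2 : ℝ) ≤ ‖z ^ 2 ^ k + 1‖ := by
        have h4 := norm_sub_norm_le (2 : ℂ) (-(z ^ 2 ^ k - 1))
        have h5 : (2 : ℂ) - -(z ^ 2 ^ k - 1) = z ^ 2 ^ k + 1 := by ring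
        rw [h5, norm_neg] at h4
        have := h (2 ^ k)
        norm_num at h4
        linarith
      rw [h2, pow_succ, mul_right_comm]
      exact mul_le_mul ih h3 (by norm_num) (norm_nonneg _)
  by_contra hz
  have hpos : 0 < ‖z - 1‖ := norm_pos_iff.2 (sub_ne_zero.2 hz)
  obtain ⟨k, hk⟩ := pow_unbounded_of_one_lt (1 / ‖z - 1‖) (by norm_num : (1 : ℝ) < 3 / 2)
  rw [div_lt_iff₀ hpos] at hk
  linarith [h1 k, h (2 ^ k)]

theorem B_lower_eq_zero {F E : Type*} [Field F] [Field E] [Algebra F E]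
    (σ : E ≃ₐ[F] E) (b : B σ) :
    mat σ b 1 0 = 0 ∧ mat σ b 2 0 = 0 ∧ mat σ b 2 1 = 0 :=
  ⟨b.2 (by decide), b.2 (by decide), b.2 (by decide)⟩

theorem entryA_mul {F E : Type*} [Field F] [Field E] [Algebra F E]
    (σ : E ≃ₐ[F] E) (b c : B σ) : entryA σ (b * c) = entryA σ b * entryA σ c := by
  obtain ⟨h1, h2, h3⟩ := B_lower_eq_zero σ c
  ext
  change mat σ ((b : G σ) * c) 0 0 = mat σ b 0 0 * mat σ c 0 0
  rw [mat_mul_apply, h1, h2]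
  ring

theorem entryB_mul {F E : Type*} [Field F] [Field E] [Algebra F E]
    (σ : E ≃ₐ[F] E) (b c : B σ) : entryB σ (b * c) = entryB σ b * entryB σ c := by
  obtain ⟨h1, h2, h3⟩ := B_lower_eq_zero σ b
  obtain ⟨k1, k2, k3⟩ := B_lower_eq_zero σ c
  ext
  change mat σ ((b : G σ) * c) 1 1 = mat σ b 1 1 * mat σ c 1 1
  rw [mat_mul_apply, h1, k3]
  ring

section

variable {F E : Type*} [Field F] [Field E] [Algebra F E] [ValuativeRel E] [TopologicalSpace E]
  [IsNonarchimedeanLocalField E] (σ : E ≃ₐ[F] E)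

/-- Every quasi-character of the norm-one group is trivial on small elements. -/
theorem exists_level (μ₂ : E1 σ →ₜ* ℂˣ) : ∃ n : ℕ, ∀ x : E1 σ,
    normAbs E ((x : Eˣ) - 1 : E) ≤ ((residueCard E : ℝ) ^ n)⁻¹ → μ₂ x = 1 := by
  have hind : Topology.IsInducing fun x : E1 σ => ((x : Eˣ) : E) :=
    (Units.isEmbedding_val₀.comp Topology.IsEmbedding.subtypeVal).isInducing
  have hU : {x : E1 σ | ‖(μ₂ x : ℂ) - 1‖ < 1 / 2} ∈ nhds (1 : E1 σ) := by
    have hc : Continuous fun x : E1 σ => ‖(μ₂ x : ℂ) - 1‖ :=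
      ((Units.continuous_val.comp μ₂.continuous_toFun).sub continuous_const).norm
    exact (isOpen_lt hc continuous_const).mem_nhds (by simp)
  rw [hind.nhds_eq_comap, Filter.mem_comap] at hU
  obtain ⟨U, hU, hUs⟩ := hU
  have hU0 : (fun y : E => y + 1) ⁻¹' U ∈ nhds (0 : E) :=
    (continuous_id.add continuous_const).continuousAt.preimage_mem_nhds (by simpa using hU)
  obtain ⟨n, hn⟩ := exists_primePow_subset hU0
  refine ⟨n, fun x hx => ?_⟩
  have hq : ((residueCard E : ℝ) ^ n)⁻¹ ≤ 1 :=
    inv_le_one_of_one_le₀ (one_le_pow₀ one_lt_residueCard_real.le)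
  have hx1 : normAbs E ((x : Eˣ) : E) ≤ 1 := by
    rw [← sub_add_cancel ((x : Eˣ) : E) 1]
    exact normAbs_add_le (hx.trans hq) normAbs_one.le
  -- The congruence neighbourhood is stable under powers, so all powers of `μ₂ x` stay within `1/2`
  -- of one.
  have hpow (k : ℕ) :
      normAbs E (((x ^ k : E1 σ) : Eˣ) - 1 : E) ≤ ((residueCard E : ℝ) ^ n)⁻¹ := by
    induction k with
    | zero => simp
    | succ k ih =>
      have e : (((x ^ (k + 1) : E1 σ) : Eˣ) - 1 : E) =
          (((x ^ k : E1 σ) : Eˣ) - 1 : E) * ((x : Eˣ) : E) + ((x : Eˣ) - 1 : E) := by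
        simp only [Subgroup.coe_pow, Units.val_pow_eq_pow_val]
        ring
      rw [e]
      refine normAbs_add_le ?_ hx
      rw [normAbs_mul]
      exact (mul_le_of_le_one_right (normAbs_nonneg _) hx1).trans ih
  refine Units.ext (eq_one_of_norm_pow_sub_one_le fun k => ?_)
  have h1 : (((x ^ k : E1 σ) : Eˣ) : E) ∈ U := by
    have := hn (show (((x ^ k : E1 σ) : Eˣ) - 1 : E) ∈ primePow E n by
      simpa [mem_primePow] using hpow k)
    simpa using this
  have h2 := hUs h1
  simp only [Set.mem_ofPred_eq, map_pow, Units.val_pow_eq_pow_val] at h2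
  exact h2.le

variable (μ₁ : Eˣ →ₜ* ℂˣ) (μ₂ : E1 σ →ₜ* ℂˣ)

/-- The factor by which elements of the induced representation transform under `B`. -/
def weight (b : B σ) : ℂ := (√(deltaB σ b) : ℂ) * muB σ μ₁ μ₂ b

theorem weight_eq (b : B σ) : weight σ μ₁ μ₂ b =
    (normAbs E (entryA σ b : E) : ℂ) * ((μ₁ (entryA σ b) : ℂ) * (μ₂ (entryB σ b) : ℂ)) := by
  rw [weight, deltaB, Real.sqrt_sq (normAbs_nonneg _), muB]

theorem weight_mul (b c : B σ) :
    weight σ μ₁ μ₂ (b * c) = weight σ μ₁ μ₂ b * weight σ μ₁ μ₂ c := by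
  simp only [weight_eq, entryA_mul, entryB_mul, map_mul, Units.val_mul, normAbs_mul,
    Complex.ofReal_mul]
  ring

theorem weight_ne_zero (b : B σ) : weight σ μ₁ μ₂ b ≠ 0 := by
  rw [weight_eq]
  simp

theorem weight_one : weight σ μ₁ μ₂ 1 = 1 := by
  have h := weight_mul σ μ₁ μ₂ 1 1
  rw [one_mul] at h
  exact (mul_eq_left₀ (weight_ne_zero σ μ₁ μ₂ 1)).1 h.symm

theorem apply_B_mul (f : indSpace σ μ₁ μ₂) (b : B σ) (g : G σ) :
    f.1 (b * g) = weight σ μ₁ μ₂ b * f.1 g := f.2.2 b g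

theorem apply_eq_zero_iff_of_last_row (f : indSpace σ μ₁ μ₂) {g g' : G σ} {t : E}
    (h : ∀ j, mat σ g' 2 j = t * mat σ g 2 j) : f.1 g' = 0 ↔ f.1 g = 0 := by
  have hb := (mul_inv_mem_B_of_last_row σ h).1
  have := apply_B_mul σ μ₁ μ₂ f ⟨_, hb⟩ g
  rw [inv_mul_cancel_right] at this
  rw [this, mul_eq_zero, or_iff_right (weight_ne_zero σ μ₁ μ₂ _)]

theorem apply_mul_of_mem_K {n : ℕ} {f : indSpace σ μ₁ μ₂}
    (hf : f ∈ fixedVectors (ind σ μ₁ μ₂) n) (g : G σ) {k : G σ} (hk : k ∈ K σ n) :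
    f.1 (g * k) = f.1 g :=
  congrFun (congrArg Subtype.val (hf k hk)) g

variable {μ₁ μ₂} (hσn : ∀ x, normAbs E (σ x) = normAbs E x)

include hσn in
theorem weight_eq_one_of_mem_K (hμ₁ : IsUnramifiedChar μ₁) {n : ℕ}
    (hμ₂ : ∀ x : E1 σ, normAbs E ((x : Eˣ) - 1 : E) ≤ ((residueCard E : ℝ) ^ n)⁻¹ → μ₂ x = 1)
    {b : B σ} (hb : (b : G σ) ∈ K σ n) : weight σ μ₁ μ₂ b = 1 := by
  have hb' := inv_mem_K σ hσn hb
  rw [mem_K_iff] at hb hb'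
  have h1 : mat σ b 0 0 * mat σ (b : G σ)⁻¹ 0 0 = 1 := by
    have h : mat σ ((b : G σ)⁻¹ * b) 0 0 = 1 := by simp
    obtain ⟨k1, k2, -⟩ := B_lower_eq_zero σ b
    rw [mat_mul_apply, k1, k2] at h
    linear_combination h
  have h2 : normAbs E (mat σ b 0 0) = 1 := by
    refine le_antisymm hb.1 ?_
    have h3 := congrArg (normAbs E) h1
    rw [normAbs_mul, normAbs_one] at h3
    rw [← h3]
    exact mul_le_of_le_one_right (normAbs_nonneg _) hb'.1
  have h3 : normAbs E (entryA σ b : E) = 1 := h2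
  rw [weight_eq, h3, hμ₁ _ h3, hμ₂ (entryB σ b) hb.2.2.2.2.1]
  simp

include hσn in
/-- If `μ₂` is trivial on elements congruent to one modulo `𝔭 ^ n`, then there are non-zero
`K_n`-fixed vectors. -/
theorem fixedVectors_ne_bot (hμ₁ : IsUnramifiedChar μ₁) {n : ℕ}
    (hμ₂ : ∀ x : E1 σ, normAbs E ((x : Eˣ) - 1 : E) ≤ ((residueCard E : ℝ) ^ n)⁻¹ → μ₂ x = 1) :
    fixedVectors (ind σ μ₁ μ₂) n ≠ ⊥ := by
  classical
  -- The function is supported on `B K_n` with value `weight b` at `b k`. It is well defined because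
  -- the weight is trivial on `B ∩ K_n`.
  let f : G σ → ℂ := fun g =>
    if h : ∃ b : B σ, (b : G σ)⁻¹ * g ∈ K σ n then weight σ μ₁ μ₂ h.choose else 0
  have hf (b : B σ) (g : G σ) (hg : (b : G σ)⁻¹ * g ∈ K σ n) : f g = weight σ μ₁ μ₂ b := by
    have h : ∃ b : B σ, (b : G σ)⁻¹ * g ∈ K σ n := ⟨b, hg⟩
    have h1 : ((b⁻¹ * h.choose : B σ) : G σ) ∈ K σ n := by
      have := mul_mem_K σ hg (inv_mem_K σ hσn h.choose_spec)
      simpa [mul_assoc] using this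
    have h2 := weight_eq_one_of_mem_K σ hσn hμ₁ hμ₂ h1
    calc f g = weight σ μ₁ μ₂ (b * (b⁻¹ * h.choose)) := by
          rw [mul_inv_cancel_left]; exact dif_pos h
      _ = _ := by rw [weight_mul, h2, mul_one]
  have hf0 (g : G σ) (hg : ¬ ∃ b : B σ, (b : G σ)⁻¹ * g ∈ K σ n) : f g = 0 := dif_neg hg
  have hB (b : B σ) (g : G σ) : f (b * g) = weight σ μ₁ μ₂ b * f g := by
    by_cases h : ∃ c : B σ, (c : G σ)⁻¹ * g ∈ K σ n
    · obtain ⟨c, hc⟩ := h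
      rw [hf c g hc, hf (b * c) (b * g) (by simpa [mul_assoc] using hc), weight_mul]
    · rw [hf0 g h, hf0 (b * g), mul_zero]
      rintro ⟨c, hc⟩
      exact h ⟨b⁻¹ * c, by simpa [mul_assoc] using hc⟩
  have hK (g k : G σ) (hk : k ∈ K σ n) : f (g * k) = f g := by
    by_cases h : ∃ c : B σ, (c : G σ)⁻¹ * g ∈ K σ n
    · obtain ⟨c, hc⟩ := h
      rw [hf c g hc, hf c (g * k) (by rw [← mul_assoc]; exact mul_mem_K σ hc hk)]
    · rw [hf0 g h, hf0 (g * k)]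
      rintro ⟨c, hc⟩
      exact h ⟨c, by simpa [mul_assoc] using mul_mem_K σ hc (inv_mem_K σ hσn hk)⟩
  have hloc : IsLocallyConstant f := by
    rw [IsLocallyConstant.iff_exists_open]
    intro g
    refine ⟨(fun x => g⁻¹ * x) ⁻¹' K σ n, (isOpen_K σ n).preimage (continuous_const_mul _),
      by simpa using one_mem_K σ hσn n, fun y hy => ?_⟩
    have := hK g (g⁻¹ * y) hy
    rwa [mul_inv_cancel_left] at this
  let v : indSpace σ μ₁ μ₂ := ⟨f, hloc, hB⟩
  intro h
  have hv : v ∈ fixedVectors (ind σ μ₁ μ₂) n := fun k hk => Subtype.ext (funext fun g => hK g k hk)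
  rw [h, Submodule.mem_bot] at hv
  have h1 : f 1 = 0 := congrFun (congrArg Subtype.val hv) 1
  rw [hf 1 1 (by simpa using one_mem_K σ hσn n), weight_one] at h1
  exact one_ne_zero h1

end

/-! ### Double cosets and vanishing of fixed vectors -/

section

variable {F E : Type*} [Field F] [Field E] [Algebra F E] [ValuativeRel E] [TopologicalSpace E]
  [IsNonarchimedeanLocalField E] (σ : E ≃ₐ[F] E)
  {μ₁ : Eˣ →ₜ* ℂˣ} {μ₂ : E1 σ →ₜ* ℂˣ}

theorem antidiagElt_mem_K {n : ℕ} {a : E} (ha0 : a ≠ 0) (hσa : σ a = a)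
    (ha : normAbs E a = ((residueCard E : ℝ) ^ n)⁻¹) : antidiagElt σ a ha0 hσa ∈ K σ n := by
  have hq : (0 : ℝ) ≤ (residueCard E : ℝ) ^ n := by positivity
  simp [mem_K_iff, antidiagElt, ha, hq]

theorem upperElt_mem_K {n : ℕ} {z : E} (h : z + σ z = 0)
    (hz : normAbs E z ≤ (residueCard E : ℝ) ^ n) : upperElt σ z h ∈ K σ n := by
  simp [mem_K_iff, upperElt, hz]

variable (hσσ : ∀ x, σ (σ x) = x) (hσn : ∀ x, normAbs E (σ x) = normAbs E x)

include hσn in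
theorem lowerElt_mem_K {n : ℕ} {x c : E} (h : c + σ c + x * σ x = 0)
    (hx : normAbs E x ≤ ((residueCard E : ℝ) ^ n)⁻¹)
    (hc : normAbs E c ≤ ((residueCard E : ℝ) ^ n)⁻¹) : lowerElt σ hσσ x c h ∈ K σ n := by
  have hq : (0 : ℝ) ≤ (residueCard E : ℝ) ^ n := by positivity
  simp [mem_K_iff, lowerElt, hσn, hx, hc, hq]

include hσn in
theorem diagElt_mem_K {n : ℕ} {t : E} (ht0 : t ≠ 0) (ht : normAbs E t = 1) :
    diagElt σ hσσ t ht0 ∈ K σ n := by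
  have hq : (0 : ℝ) ≤ (residueCard E : ℝ) ^ n := by positivity
  simp [mem_K_iff, diagElt, hσn, ht, hq]

variable (h2 : normAbs E 2 = 1)

include hσσ h2 in
theorem half_norm_trace (x : E) : -(x * σ x) / 2 + σ (-(x * σ x) / 2) + x * σ x = 0 := by
  have h20 : (2 : E) ≠ 0 := fun h => by simp [h] at h2
  simp only [map_div₀, map_neg, map_mul, hσσ, map_ofNat]
  field_simp
  ring

/-- The lower unipotent element with last row `(-x * σ x / 2, x, 1)`. -/
def gammaElt (x : E) : G σ := lowerElt σ hσσ x (-(x * σ x) / 2) (half_norm_trace σ hσσ h2 x)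

include hσn h2 in
theorem normAbs_half_norm (x : E) : normAbs E (-(x * σ x) / 2) = normAbs E x ^ 2 := by
  rw [normAbs_div, normAbs_neg, normAbs_mul, hσn, h2, div_one, sq]

include hσn in
/-- Up to `B` on the left and `K_n` on the right, every element of `G` is some `gammaElt`. -/
theorem exists_mul_last_row_eq {ϖ : E} (hϖ : normAbs E ϖ = (residueCard E : ℝ)⁻¹)
    (hσϖ : σ ϖ = ϖ) (n : ℕ) (g : G σ) : ∃ k ∈ K σ n, ∃ x t : E,
      normAbs E x ^ 2 ≤ ((residueCard E : ℝ) ^ n)⁻¹ ∧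
      ∀ j, mat σ (g * k) 2 j = t * mat σ (gammaElt σ hσσ h2 x) 2 j := by
  have hq : (0 : ℝ) < (residueCard E : ℝ) ^ n := pow_pos residueCard_pos n
  obtain ⟨k, hk, hle⟩ : ∃ k ∈ K σ n, normAbs E (mat σ (g * k) 2 0) * (residueCard E : ℝ) ^ n ≤
      normAbs E (mat σ (g * k) 2 2) := by
    rcases le_total (normAbs E (mat σ g 2 0) * (residueCard E : ℝ) ^ n)
      (normAbs E (mat σ g 2 2)) with h | h
    · exact ⟨1, one_mem_K σ hσn n, by simpa using h⟩
    -- The antidiagonal element of `K_n` exchanges the outer entries up to the scalars `ϖ ^ n` and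
    -- `ϖ ^ (-n)`, which reverses the inequality.
    · have ha : normAbs E (ϖ ^ n) = ((residueCard E : ℝ) ^ n)⁻¹ := by simp [hϖ]
      have ha0 : ϖ ^ n ≠ 0 := fun h => by
        rw [h, normAbs_zero] at ha
        exact (inv_pos.2 hq).ne ha
      refine ⟨antidiagElt σ (ϖ ^ n) ha0 (by simp [hσϖ]), antidiagElt_mem_K σ ha0 _ ha, ?_⟩
      rw [mat_mul_apply, mat_mul_apply]
      simp only [antidiagElt, mat_ofMat]
      simpa [hϖ, hq.ne'] using h
  set x0 := mat σ (g * k) 2 0 with hx0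
  set x1 := mat σ (g * k) 2 1 with hx1
  set x2 := mat σ (g * k) 2 2 with hx2
  have hiso := isotropic_last_row σ (g * k)
  rw [← hx0, ← hx1, ← hx2] at hiso
  have hx20 : x2 ≠ 0 := by
    intro h
    have h0 : x0 = 0 := by
      rw [h, normAbs_zero] at hle
      exact normAbs_eq_zero.1 (le_antisymm (nonpos_of_mul_nonpos_left hle hq) (normAbs_nonneg _))
    have h1 : x1 = 0 := by
      rw [h, h0] at hiso
      simpa using hiso
    obtain ⟨j, hj⟩ := last_row_ne_zero σ (g * k)
    fin_cases j
    exacts [hj h0, hj h1, hj h]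
  have hσx20 : σ x2 ≠ 0 := by simpa using hx20
  have hy : normAbs E (x0 / x2) ≤ ((residueCard E : ℝ) ^ n)⁻¹ := by
    rw [normAbs_div, div_le_iff₀ (normAbs_pos hx20), inv_mul_eq_div, le_div_iff₀ hq]
    exact hle
  have htr : x0 / x2 + σ (x0 / x2) = -(x1 / x2 * σ (x1 / x2)) := by
    simp only [map_div₀]
    field_simp
    linear_combination hiso
  have hx : normAbs E (x1 / x2) ^ 2 ≤ ((residueCard E : ℝ) ^ n)⁻¹ := by
    have := normAbs_add_le hy ((hσn _).trans_le hy)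
    rwa [htr, normAbs_neg, normAbs_mul, hσn, ← sq] at this
  -- By isotropy `x0 / x2` and `-N(x1 / x2) / 2` have the same trace. Their difference is therefore
  -- an admissible corner entry of a lower unipotent, which moves the row to a multiple of that of
  -- `gammaElt`.
  have hc : (-(x1 / x2 * σ (x1 / x2)) / 2 - x0 / x2) +
      σ (-(x1 / x2 * σ (x1 / x2)) / 2 - x0 / x2) + 0 * σ 0 = 0 := by
    have h3 := half_norm_trace σ hσσ h2 (x1 / x2)
    rw [map_sub]
    linear_combination h3 - htr
  refine ⟨k * lowerElt σ hσσ 0 _ hc, mul_mem_K σ hk (lowerElt_mem_K σ hσσ hσn hc (by simp)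
    (normAbs_sub_le ((normAbs_half_norm σ hσn h2 _).trans_le hx) hy)), x1 / x2, x2, hx, ?_⟩
  intro j
  rw [← mul_assoc, mat_mul_apply, ← hx0, ← hx1, ← hx2]
  simp only [lowerElt, gammaElt, mat_ofMat]
  fin_cases j <;> simp
  all_goals field_simp
  all_goals ring

-- An element `k` of `K_n` that fixes the last row of `gammaElt x` satisfies `gammaElt x * k = b *
-- gammaElt x` with `b` in `B`. Non-vanishing of `f` there forces `b` to have weight one. Here `b`
-- has diagonal `1, β, 1`, so `μ₂ β = 1`.
include hσσ hσn h2 in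
theorem character_eq_one_of_apply_gammaElt_ne_zero {n : ℕ} {f : indSpace σ μ₁ μ₂}
    (hf : f ∈ fixedVectors (ind σ μ₁ μ₂) n) {x τ : E} (hx0 : x ≠ 0)
    (hx : normAbs E x ^ 2 ≤ ((residueCard E : ℝ) ^ n)⁻¹)
    (hfx : f.1 (gammaElt σ hσσ h2 x) ≠ 0) (hτ : τ + σ τ = 0) (ht : normAbs E (1 + τ) = 1)
    (hτx : normAbs E τ ≤ normAbs E x ^ 2 * (residueCard E : ℝ) ^ n)
    {β : E1 σ} (hβ : ((β : Eˣ) : E) * (1 + τ) = σ (1 + τ)) : μ₂ β = 1 := by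
  have hq : (0 : ℝ) < (residueCard E : ℝ) ^ n := pow_pos residueCard_pos n
  have h20 : (2 : E) ≠ 0 := fun h => by simp [h] at h2
  set t := 1 + τ with htdef
  have ht0 : t ≠ 0 := fun h => by simp [h] at ht
  have hσt0 : σ t ≠ 0 := by simpa using ht0
  have hσx0 : σ x ≠ 0 := by simpa using hx0
  have hστ : σ τ = -τ := by linear_combination hτ
  have hσt : σ t = 1 - τ := by rw [htdef, map_add, map_one, hστ]; ring
  set c := -(x * σ x) / 2 with hc
  have hc0 : c ≠ 0 := div_ne_zero (neg_ne_zero.2 (mul_ne_zero hx0 hσx0)) h20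
  have hσc : σ c = c := by
    simp only [hc, map_div₀, map_neg, map_mul, hσσ, map_ofNat, mul_comm]
  have hcn : normAbs E c = normAbs E x ^ 2 := normAbs_half_norm σ hσn h2 x
  have hx2 : 0 < normAbs E x ^ 2 := pow_pos (normAbs_pos hx0) 2
  have hz : τ / c + σ (τ / c) = 0 := by rw [map_div₀, hσc, hστ]; ring
  have hy : c * τ / (t * σ t) + σ (c * τ / (t * σ t)) + 0 * σ 0 = 0 := by
    simp only [map_div₀, map_mul, hσσ, hσc, hστ]
    ring
  -- The factors move the last row `(c, x, 1)` to `(c, x, t)`, then `(c / σ t, x, t)`, then back to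
  -- `(c, x, 1)`.
  let k : G σ := upperElt σ (τ / c) hz * lowerElt σ hσσ 0 (c * τ / (t * σ t)) hy *
    diagElt σ hσσ t⁻¹ (inv_ne_zero ht0)
  have hk : k ∈ K σ n := by
    refine mul_mem_K σ (mul_mem_K σ (upperElt_mem_K σ hz ?_) (lowerElt_mem_K σ hσσ hσn hy
      (by simp) ?_)) (diagElt_mem_K σ hσσ hσn _ (by simp [ht]))
    · rw [normAbs_div, hcn, div_le_iff₀ hx2, mul_comm]
      exact hτx
    · rw [normAbs_div, normAbs_mul, normAbs_mul, hσn, ht, hcn, mul_one, div_one]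
      calc normAbs E x ^ 2 * normAbs E τ
          ≤ normAbs E x ^ 2 * (normAbs E x ^ 2 * (residueCard E : ℝ) ^ n) := by gcongr
        _ ≤ ((residueCard E : ℝ) ^ n)⁻¹ * (((residueCard E : ℝ) ^ n)⁻¹ *
              (residueCard E : ℝ) ^ n) := by gcongr
        _ = _ := by field_simp
  set γ := gammaElt σ hσσ h2 x with hγ
  have hrow (j : Fin 3) : mat σ (γ * k) 2 j = 1 * mat σ γ 2 j := by
    have e : γ * k = γ * upperElt σ (τ / c) hz * lowerElt σ hσσ 0 (c * τ / (t * σ t)) hy *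
      diagElt σ hσσ t⁻¹ (inv_ne_zero ht0) := by simp only [k, mul_assoc]
    rw [e]
    simp only [mat_mul_apply, hγ, gammaElt, upperElt, lowerElt, diagElt, mat_ofMat, ← hc]
    fin_cases j
    · simp
      field_simp
      rw [hσt, htdef]
      ring
    · simp
    · simp
      field_simp
      rw [htdef]
      ring
  obtain ⟨hb, hb0, hb2⟩ := mul_inv_mem_B_of_last_row σ hrow
  rw [map_one, inv_one] at hb0
  let b : B σ := ⟨_, hb⟩
  -- The outer diagonal entries of `b` are one, so its middle entry is `det b = det k = σ t / t`.
  have hb1 : mat σ b 1 1 = (β : Eˣ) := by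
    have hdet : (mat σ b).det = mat σ b 1 1 := by
      have e0 : mat σ b 0 0 = 1 := hb0
      have e2 : mat σ b 2 2 = 1 := hb2
      rw [Matrix.det_of_isUpperTriangular b.2, Fin.prod_univ_three, e0, e2, one_mul, mul_one]
    have hdet' : (mat σ b).det = (mat σ k).det := by
      change (mat σ (γ * k * γ⁻¹)).det = _
      have h1 : (mat σ γ).det * (mat σ γ⁻¹).det = 1 := by
        rw [← Matrix.det_mul, ← mat_mul, mul_inv_cancel, mat_one, Matrix.det_one]
      rw [mat_mul, mat_mul, Matrix.det_mul, Matrix.det_mul]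
      linear_combination (mat σ k).det * h1
    rw [← hdet, hdet']
    simp only [k, mat_mul, Matrix.det_mul, upperElt, lowerElt, diagElt, mat_ofMat,
      Matrix.det_fin_three]
    simp
    rw [← hβ]
    field_simp
  have hA : entryA σ b = 1 := Units.ext hb0
  have hB : entryB σ b = β := Subtype.ext (Units.ext hb1)
  have h3 : f.1 γ = weight σ μ₁ μ₂ b * f.1 γ := by
    rw [← apply_B_mul, ← apply_mul_of_mem_K σ μ₁ μ₂ hf γ hk]
    simp [b]
  have h4 : weight σ μ₁ μ₂ b = 1 := (mul_eq_right₀ hfx).1 h3.symm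
  rw [weight_eq, hA, hB] at h4
  exact Units.ext (by simpa using h4)

include hσσ hσn h2 in
theorem eq_zero_of_apply_one_eq_zero (hμ₁ : IsUnramifiedChar μ₁)
    {ϖ : E} (hϖ : normAbs E ϖ = (residueCard E : ℝ)⁻¹) (hσϖ : σ ϖ = ϖ)
    {s : E} (hσs : σ s = -s) (hs : normAbs E s = 1) (hs1 : normAbs E (1 + s) = 1)
    {n : ℕ} (hn : n ≤ conductor (ind σ μ₁ μ₂) + 1) {f : indSpace σ μ₁ μ₂}
    (hf : f ∈ fixedVectors (ind σ μ₁ μ₂) n) (hf1 : f.1 1 = 0) : f = 0 := by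
  have hq : (0 : ℝ) < (residueCard E : ℝ) ^ n := pow_pos residueCard_pos n
  have h20 : (2 : E) ≠ 0 := fun h => by simp [h] at h2
  refine Subtype.ext (funext fun g => by_contra fun hg => ?_)
  obtain ⟨k, hk, x, t, hx, hrow⟩ := exists_mul_last_row_eq σ hσσ hσn h2 hϖ hσϖ n g
  have hfx : f.1 (gammaElt σ hσσ h2 x) ≠ 0 := by
    rw [Ne, ← apply_eq_zero_iff_of_last_row σ μ₁ μ₂ f hrow, apply_mul_of_mem_K σ μ₁ μ₂ hf g hk]
    exact hg
  rcases le_or_gt (normAbs E x) ((residueCard E : ℝ) ^ n)⁻¹ with hxn | hxn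
  · have hmem : gammaElt σ hσσ h2 x ∈ K σ n :=
      lowerElt_mem_K σ hσσ hσn _ hxn ((normAbs_half_norm σ hσn h2 x).trans_le hx)
    have := apply_mul_of_mem_K σ μ₁ μ₂ hf 1 hmem
    rw [one_mul, hf1] at this
    exact hfx this
  have hx0 : x ≠ 0 := by
    rintro rfl
    rw [normAbs_zero] at hxn
    exact (inv_pos.2 hq).not_gt hxn
  obtain ⟨i, hi⟩ := exists_normAbs_eq_zpow hx0
  have hin : -(n : ℤ) < i := by
    rw [hi, ← zpow_natCast, ← zpow_neg, zpow_lt_zpow_iff_right₀ one_lt_residueCard_real] at hxn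
    exact hxn
  have hin' : i * 2 ≤ -n := by
    rw [hi, ← zpow_natCast, ← zpow_natCast, ← zpow_neg, ← zpow_mul,
      zpow_le_zpow_iff_right₀ one_lt_residueCard_real] at hx
    exact hx
  -- `m` is chosen so that `|x|² q_E ^ n = q_E ^ (-m)`, the bound on `τ`. As `i ≥ 1 - n`, it
  -- satisfies `m ≤ n - 2`.
  obtain ⟨m, hm⟩ : ∃ m : ℕ, (m : ℤ) = -(i * 2) - n := ⟨_, Int.toNat_of_nonneg (by omega)⟩
  have hxm : normAbs E x ^ 2 * (residueCard E : ℝ) ^ n = ((residueCard E : ℝ) ^ m)⁻¹ := by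
    rw [hi, ← zpow_natCast, ← zpow_natCast, ← zpow_natCast, ← zpow_neg, ← zpow_mul,
      ← zpow_add₀ residueCard_pos.ne', hm]
    congr 1
    push_cast
    ring
  have hE1 (β : E1 σ) : ((β : Eˣ) : E) * σ (β : Eˣ) = 1 := β.2
  -- The Cayley transform `τ = (1 - β) / (1 + β)` has trace zero and recovers `β` as `σ (1 + τ) / (1
  -- + τ)`. It is integral when `1 + β` is a unit.
  have key (β : E1 σ) (hβ : normAbs E ((β : Eˣ) - 1 : E) ≤ ((residueCard E : ℝ) ^ m)⁻¹)
      (hβ1 : normAbs E (1 + (β : Eˣ) : E) = 1) : μ₂ β = 1 := by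
    have hb0 : (1 + (β : Eˣ) : E) ≠ 0 := fun h => by simp [h] at hβ1
    have hb0' : ((β : Eˣ) : E) ≠ 0 := Units.ne_zero _
    have hσβ : σ (β : Eˣ) = ((β : Eˣ) : E)⁻¹ := eq_inv_of_mul_eq_one_right (hE1 β)
    have h1 : (1 + ((β : Eˣ) : E)⁻¹) = (1 + (β : Eˣ)) / (β : Eˣ) := by
      field_simp
      ring
    have hστ : σ ((1 - (β : Eˣ)) / (1 + (β : Eˣ)) : E) =
        -((1 - (β : Eˣ)) / (1 + (β : Eˣ)) : E) := by
      simp only [map_div₀, map_sub, map_one, map_add, hσβ, h1]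
      field_simp
      ring
    have ht : (1 + (1 - (β : Eˣ)) / (1 + (β : Eˣ)) : E) = 2 / (1 + (β : Eˣ)) := by
      field_simp
      ring
    refine character_eq_one_of_apply_gammaElt_ne_zero σ hσσ hσn h2 hf hx0 hx hfx
      (τ := (1 - (β : Eˣ)) / (1 + (β : Eˣ))) (by rw [hστ]; ring) ?_ ?_ ?_
    · rw [ht, normAbs_div, h2, hβ1, div_one]
    · rw [hxm, normAbs_div, hβ1, div_one, normAbs_sub_comm]
      exact hβ
    · rw [map_add, map_one, hστ]
      field_simp
      ring
  have hlevel : ∀ β : E1 σ,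
      normAbs E ((β : Eˣ) - 1 : E) ≤ ((residueCard E : ℝ) ^ m)⁻¹ → μ₂ β = 1 := by
    intro β hβ
    have hq' : ((residueCard E : ℝ) ^ m)⁻¹ ≤ 1 :=
      inv_le_one_of_one_le₀ (one_le_pow₀ one_lt_residueCard_real.le)
    by_cases hβ1 : normAbs E (1 + (β : Eˣ) : E) = 1
    · exact key β hβ hβ1
    have e : (1 + (β : Eˣ) : E) = 2 + ((β : Eˣ) - 1) := by ring
    have hle : normAbs E (1 + (β : Eˣ) : E) ≤ 1 := by
      rw [e]
      exact normAbs_add_le h2.le (hβ.trans hq')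
    have hlt := lt_of_le_of_ne hle hβ1
    have hm0 : m = 0 := by
      by_contra hm0
      apply hβ1
      rw [e, ← h2]
      refine normAbs_add_eq_left (hβ.trans_lt ?_)
      rw [h2]
      exact inv_lt_one_of_one_lt₀ (one_lt_pow₀ one_lt_residueCard_real hm0)
    subst hm0
    rw [pow_zero, inv_one] at key
    have hs10 : 1 + s ≠ 0 := fun h => by simp [h] at hs1
    have hs10' : 1 - s ≠ 0 := by
      intro h
      apply hs10
      have := congrArg σ h
      simpa [hσs] using this
    have hb1 : normAbs E (1 - s) = 1 := by
      rw [← hs1, ← hσn (1 + s), map_add, map_one, hσs, sub_eq_add_neg]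
    -- For `β` congruent to `-1`, possible only at level zero, the Cayley transform is not
    -- available. Both `β₀` and `β β₀⁻¹` avoid the residue class of `-1`, so `key` applies to each.
    let β₀ : E1 σ := ⟨Units.mk0 ((1 - s) / (1 + s)) (div_ne_zero hs10' hs10), by
      change (1 - s) / (1 + s) * σ ((1 - s) / (1 + s)) = 1
      simp only [map_div₀, map_sub, map_add, map_one, hσs, sub_neg_eq_add, ← sub_eq_add_neg]
      field_simp⟩
    have hβ₀ : ((β₀ : Eˣ) : E) = (1 - s) / (1 + s) := rfl
    have hbound (β : E1 σ) : normAbs E ((β : Eˣ) - 1 : E) ≤ 1 := by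
      refine normAbs_sub_le ?_ normAbs_one.le
      have := congrArg (normAbs E) (hE1 β)
      rw [normAbs_mul, hσn, ← sq, normAbs_one] at this
      exact ((pow_eq_one_iff_of_nonneg (normAbs_nonneg _) two_ne_zero).1 this).le
    have h1 : μ₂ β₀ = 1 := by
      refine key _ (hbound _) ?_
      have e1 : 1 + (1 - s) / (1 + s) = 2 / (1 + s) := by field_simp; ring
      rw [hβ₀, e1, normAbs_div, h2, hs1, div_one]
    have h3 : μ₂ (β * β₀⁻¹) = 1 := by
      refine key _ (hbound _) ?_
      have e1 : (1 + (((β * β₀⁻¹ : E1 σ) : Eˣ) : E)) =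
          (-(2 * s / (1 + s)) + (1 + (β : Eˣ))) * ((1 + s) / (1 - s)) := by
        simp only [Subgroup.coe_mul, Subgroup.coe_inv, Units.val_mul, Units.val_inv_eq_inv_val, hβ₀]
        field_simp
        ring
      have e2 : normAbs E (-(2 * s / (1 + s))) = 1 := by
        rw [normAbs_neg, normAbs_div, normAbs_mul, h2, hs, hs1]
        norm_num
      rw [e1, normAbs_mul, normAbs_div, hs1, hb1, normAbs_add_eq_left (by rwa [e2]), e2]
      norm_num
    rw [map_mul, map_inv, h1, inv_one, mul_one] at h3
    exact h3
  have hN : conductor (ind σ μ₁ μ₂) ≤ m := Nat.sInf_le (fixedVectors_ne_bot σ hσn hμ₁ hlevel)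
  omega

end

/-! ### The quadratic character as a sign of the valuation -/

section Omega

variable {F E : Type*}
    [Field F] [ValuativeRel F] [TopologicalSpace F] [IsNonarchimedeanLocalField F] [CharZero F]
    [Field E] [ValuativeRel E] [TopologicalSpace E] [IsNonarchimedeanLocalField E]
    [Algebra F E] [ValuativeExtension F E] {ε : F} {s : E}

/-- Units and squares are norms, which settles even valuation. Every norm has even valuation because
`E / F` is unramified. -/
theorem omegaEF_eq (hF : ringChar 𝓀[F] ≠ 2) (hε : valuation F ε = 1)
    (hsq : ¬ IsSquare ε) (hs : s ^ 2 = algebraMap F E ε) (hadj : Algebra.adjoin F {s} = ⊤)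
    {σ : E ≃ₐ[F] E} (hσ : σ ≠ 1) {x : Fˣ} {k : ℤ}
    (hk : normAbs F (x : F) = (residueCard F : ℝ) ^ k) : omegaEF F E x = (-1) ^ k := by
  have hnorm := algebraMap_norm_eq hs hsq hadj hσ
  have hq : (0 : ℝ) < residueCard F := residueCard_pos
  rcases Int.even_or_odd k with hk' | hk'
  · rw [hk'.neg_one_zpow]
    refine if_pos ?_
    obtain ⟨j, rfl⟩ := hk'
    obtain ⟨c, hc0, hc⟩ := exists_normAbs_eq (K := F) j
    have hu : normAbs F ((x : F) / (c * c)) = 1 := by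
      rw [normAbs_div, normAbs_mul, hk, hc, ← zpow_add₀ hq.ne', div_self (zpow_pos hq _).ne']
    obtain ⟨y, hy⟩ := exists_norm_eq_of_unit hF hε hsq hs hadj hσ hu
    refine ⟨algebraMap F E c * y, (algebraMap F E).injective ?_⟩
    rw [hnorm, map_mul, AlgEquiv.commutes, mul_mul_mul_comm, ← hnorm, hy, ← map_mul, ← map_mul,
      mul_div_cancel₀ _ (mul_ne_zero hc0 hc0)]
  · rw [hk'.neg_one_zpow]
    refine if_neg ?_
    rintro ⟨y, hy⟩
    have hy0 : y ≠ 0 := by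
      rintro rfl
      refine x.ne_zero ((algebraMap F E).injective ?_)
      rw [← hy, hnorm, zero_mul, map_zero]
    obtain ⟨j, hj⟩ := exists_normAbs_eq_zpow hy0
    have h := congrArg (normAbs E) (hnorm y)
    rw [hy, normAbs_algebraMap hF hε hsq hs hadj, normAbs_mul,
      normAbs_galois hF hε hsq hs hadj hσ, ← sq,
      pow_left_inj₀ (normAbs_nonneg _) (normAbs_nonneg _) two_ne_zero, hk, hj,
      residueCard_eq_sq hF hε hsq hs hadj, Nat.cast_pow, ← zpow_natCast, ← zpow_mul,
      zpow_right_inj₀ hq one_lt_residueCard_real.ne'] at h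
    rw [h] at hk'
    exact (Int.not_odd_iff_even.2 ⟨j, by push_cast; ring⟩) hk'

end Omega

/-! ### Cosets of `K_n ∩ K_{n+1}` in `K_{n+1}` -/

section Cosets

variable {F E : Type*} [Field F] [Field E] [Algebra F E] (σ : E ≃ₐ[F] E)

theorem trace_mul_generator {s : E} (hσs : σ s = -s) (a : F) :
    algebraMap F E a * s + σ (algebraMap F E a * s) = 0 := by
  rw [map_mul, AlgEquiv.commutes, hσs]
  ring

variable [ValuativeRel F]

/-- A section of the reduction map of the ring of integers. -/
def residueLift : 𝓀[F] → 𝒪[F] := Function.surjInv IsLocalRing.residue_surjective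

theorem residue_residueLift (r : 𝓀[F]) : IsLocalRing.residue 𝒪[F] (residueLift r) = r :=
  Function.surjInv_eq _ r

/-- Representatives of the cosets of `K_n ∩ K_{n+1}` in `K_{n+1}`. -/
def cosetRep {s : E} (hσs : σ s = -s) {ϖ : F} (hϖ0 : ϖ ≠ 0) (n : ℕ) : Option 𝓀[F] → G σ
  | none => antidiagElt σ (algebraMap F E (ϖ ^ (n + 1))) (by simpa using hϖ0)
      (AlgEquiv.commutes σ _)
  | some r => upperElt σ (algebraMap F E ((residueLift r : F) / ϖ ^ (n + 1)) * s)
      (trace_mul_generator σ hσs _)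

variable [TopologicalSpace F] [IsNonarchimedeanLocalField F] [ValuativeRel E]
  [TopologicalSpace E] [IsNonarchimedeanLocalField E] [ValuativeExtension F E]
  {s : E} (hσs : σ s = -s) {ϖ : F} (hϖ0 : ϖ ≠ 0)
  (hϖ : normAbs E (algebraMap F E ϖ) = (residueCard E : ℝ)⁻¹)
  (hσn : ∀ x, normAbs E (σ x) = normAbs E x)

omit [TopologicalSpace F] [IsNonarchimedeanLocalField F] [ValuativeRel F]
  [ValuativeExtension F E] in
theorem mem_K_of_mem_K_succ {n : ℕ} {g : G σ} (hg : g ∈ K σ (n + 1))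
    (h : normAbs E (mat σ g 0 2) ≤ (residueCard E : ℝ) ^ n) : g ∈ K σ n := by
  have hq : ((residueCard E : ℝ) ^ (n + 1))⁻¹ ≤ ((residueCard E : ℝ) ^ n)⁻¹ :=
    inv_anti₀ (pow_pos residueCard_pos n)
      (pow_le_pow_right₀ one_lt_residueCard_real.le n.le_succ)
  rw [mem_K_iff] at *
  obtain ⟨a1, a2, a3, a4, a5, a6, a7, a8, a9⟩ := hg
  exact ⟨a1, a2, h, a4.trans hq, a5.trans hq, a6, a7.trans hq, a8.trans hq, a9⟩

include hϖ in
theorem cosetRep_mem_K (hs : normAbs E s = 1) (n : ℕ) (o : Option 𝓀[F]) :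
    cosetRep σ hσs hϖ0 n o ∈ K σ (n + 1) := by
  cases o with
  | none => exact antidiagElt_mem_K σ (by simpa using hϖ0) (AlgEquiv.commutes σ _) (by simp [hϖ])
  | some r =>
    refine upperElt_mem_K σ (trace_mul_generator σ hσs _) ?_
    have h : normAbs E (algebraMap F E (residueLift r : F)) ≤ 1 :=
      normAbs_algebraMap_le_one_iff.2 (normAbs_le_one_iff.2 (residueLift r).2)
    rw [normAbs_mul, hs, mul_one, map_div₀, normAbs_div, map_pow, normAbs_pow, hϖ, inv_pow,
      div_inv_eq_mul]
    exact mul_le_of_le_one_left (pow_pos residueCard_pos _).le h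

-- Modulo `𝔭_E ^ (-n)`, the trace-zero elements `F s` of `𝔭_E ^ (-n-1)` are parametrized by the
-- residue field of `F`, not of `E`. This is why there are `q` unipotent cosets.
include hϖ in
theorem normAbs_residueLift_sub_le (hs : normAbs E s = 1) (n : ℕ) {a : 𝒪[F]} {r : 𝓀[F]} :
    normAbs E (algebraMap F E ((residueLift r : F) / ϖ ^ (n + 1)) * s -
      algebraMap F E ((a : F) / ϖ ^ (n + 1)) * s) ≤ (residueCard E : ℝ) ^ n ↔
    IsLocalRing.residue 𝒪[F] a = r := by
  have hq : (0 : ℝ) < (residueCard E : ℝ) ^ n := pow_pos residueCard_pos n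
  have hq1 : (0 : ℝ) < residueCard E := residueCard_pos
  have e : algebraMap F E ((residueLift r : F) / ϖ ^ (n + 1)) * s -
      algebraMap F E ((a : F) / ϖ ^ (n + 1)) * s =
      algebraMap F E ((residueLift r - a : 𝒪[F]) : F) * s / algebraMap F E ϖ ^ (n + 1) := by
    change _ = algebraMap F E ((residueLift r : F) - a) * s / algebraMap F E ϖ ^ (n + 1)
    simp only [map_div₀, map_pow, map_sub]
    ring
  have h1 (x : ℝ) : x / ((residueCard E : ℝ)⁻¹) ^ (n + 1) ≤ (residueCard E : ℝ) ^ n ↔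
      x ≤ (residueCard E : ℝ)⁻¹ := by
    rw [div_le_iff₀ (by positivity)]
    congr! 1
    rw [inv_pow, pow_succ]
    field_simp
  rw [e, normAbs_div, normAbs_mul, hs, mul_one, normAbs_pow, hϖ, h1, ← normAbs_lt_one_iff_le_inv,
    normAbs_algebraMap_lt_one_iff, ← residue_eq_zero_iff, map_sub, residue_residueLift,
    sub_eq_zero, eq_comm]

include hϖ hσn in
theorem eq_of_cosetRep_inv_mul_mem (hs : normAbs E s = 1) (n : ℕ) {o o' : Option 𝓀[F]}
    (h : (cosetRep σ hσs hϖ0 n o)⁻¹ * cosetRep σ hσs hϖ0 n o' ∈ K σ n) : o = o' := by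
  have hlt : ¬ ((residueCard E : ℝ) ^ (n + 1) ≤ (residueCard E : ℝ) ^ n) :=
    (pow_lt_pow_right₀ one_lt_residueCard_real n.lt_succ_self).not_ge
  have key (r : 𝓀[F]) :
      (cosetRep σ hσs hϖ0 n (some r))⁻¹ * cosetRep σ hσs hϖ0 n none ∉ K σ n := by
    intro h
    have h1 := ((mem_K_iff σ).1 h).2.2.1
    rw [mat_mul_apply, mat_inv_apply, mat_inv_apply, mat_inv_apply] at h1
    simp [cosetRep, antidiagElt, upperElt, Fin.rev, hϖ] at h1
    exact hlt h1
  cases o with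
  | none =>
    cases o' with
    | none => rfl
    | some r =>
      refine absurd (inv_mem_K σ hσn h) ?_
      rw [mul_inv_rev, inv_inv]
      exact key r
  | some r =>
    cases o' with
    | none => exact absurd h (key r)
    | some r' =>
      have h1 := ((mem_K_iff σ).1 h).2.2.1
      rw [mat_mul_apply, mat_inv_apply, mat_inv_apply, mat_inv_apply] at h1
      simp only [cosetRep, upperElt, mat_ofMat, Fin.rev] at h1
      have h2 := (normAbs_residueLift_sub_le (ϖ := ϖ) hϖ hs n (a := residueLift r) (r := r')).1 (by
        refine le_of_eq_of_le (congrArg _ ?_) h1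
        simp [hσs]
        ring)
      rw [residue_residueLift] at h2
      rw [h2]

include hϖ hσn in
theorem exists_cosetRep_inv_mul_mem (hs : normAbs E s = 1)
    (hmax : ∀ a b : F, normAbs E (algebraMap F E a + algebraMap F E b * s) =
      max (normAbs E (algebraMap F E a)) (normAbs E (algebraMap F E b)))
    (hspan : ∀ x : E, ∃ a b : F, x = algebraMap F E a + algebraMap F E b * s)
    (h2 : normAbs E 2 = 1)
    (n : ℕ) {k : G σ} (hk : k ∈ K σ (n + 1)) :
    ∃ o, (cosetRep σ hσs hϖ0 n o)⁻¹ * k ∈ K σ n := by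
  have hq : (0 : ℝ) < (residueCard E : ℝ) := residueCard_pos
  have hmem (o) : (cosetRep σ hσs hϖ0 n o)⁻¹ * k ∈ K σ (n + 1) :=
    mul_mem_K σ (inv_mem_K σ hσn (cosetRep_mem_K σ hσs hϖ0 hϖ hs n o)) hk
  have hk' := (mem_K_iff σ).1 hk
  obtain ⟨a1, a2, a3, a4, a5, a6, a7, a8, a9⟩ := hk'
  -- In `K_{n+1}` only the upper right entry obstructs membership in `K_n`. The antidiagonal
  -- representative handles a non-unit lower right entry, and a unipotent one handles a unit.
  rcases lt_or_eq_of_le a9 with h | h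
  · refine ⟨none, mem_K_of_mem_K_succ σ (hmem _) ?_⟩
    rw [normAbs_lt_one_iff_le_inv] at h
    rw [mat_mul_apply, mat_inv_apply, mat_inv_apply, mat_inv_apply]
    simp [cosetRep, antidiagElt, Fin.rev, hϖ]
    calc (residueCard E : ℝ) ^ (n + 1) * normAbs E (mat σ k 2 2)
        ≤ (residueCard E : ℝ) ^ (n + 1) * (residueCard E : ℝ)⁻¹ := by gcongr
      _ = _ := by rw [pow_succ]; field_simp
  · have hk0 : mat σ k 2 2 ≠ 0 := fun h0 => by simp [h0] at h
    have hσk0 : σ (mat σ k 2 2) ≠ 0 := by simpa using hk0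
    obtain ⟨a, b, hab⟩ := hspan (mat σ k 0 2 / mat σ k 2 2)
    have hiso := isotropic_last_col σ k
    -- Isotropy of the last column makes the component of the quotient in `F` integral, so only its
    -- `s`-component has to be removed by the representative.
    have htr : algebraMap F E a * 2 =
        -(mat σ k 1 2 / mat σ k 2 2 * σ (mat σ k 1 2 / mat σ k 2 2)) := by
      have h3 : mat σ k 0 2 / mat σ k 2 2 + σ (mat σ k 0 2 / mat σ k 2 2) =
          algebraMap F E a * 2 := by
        rw [hab]
        simp only [map_add, map_mul, AlgEquiv.commutes, hσs]
        ring
      rw [← h3]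
      simp only [map_div₀]
      field_simp
      linear_combination hiso
    have ha : normAbs E (algebraMap F E a) ≤ 1 := by
      have h3 := congrArg (normAbs E) htr
      rw [normAbs_mul, h2, mul_one, normAbs_neg, normAbs_mul, hσn, normAbs_div, h, div_one] at h3
      rw [h3]
      exact mul_le_one₀ a6 (normAbs_nonneg _) a6
    have hb : normAbs E (algebraMap F E b) ≤ (residueCard E : ℝ) ^ (n + 1) := by
      refine (le_max_right _ _).trans ((hmax a b).symm.trans_le ?_)
      rw [← hab, normAbs_div, h, div_one]
      exact a3
    have hb' : valuation F (b * ϖ ^ (n + 1)) ≤ 1 := by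
      rw [← normAbs_le_one_iff, ← normAbs_algebraMap_le_one_iff (E := E), map_mul, normAbs_mul,
        map_pow, normAbs_pow, hϖ, inv_pow, ← div_eq_mul_inv, div_le_one (pow_pos hq _)]
      exact hb
    let b' : 𝒪[F] := ⟨b * ϖ ^ (n + 1), hb'⟩
    have hbb : (b' : F) / ϖ ^ (n + 1) = b := mul_div_cancel_right₀ _ (pow_ne_zero _ hϖ0)
    refine ⟨some (IsLocalRing.residue 𝒪[F] b'), mem_K_of_mem_K_succ σ (hmem _) ?_⟩
    have h3 := (normAbs_residueLift_sub_le (ϖ := ϖ) hϖ hs n (a := b')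
      (r := IsLocalRing.residue 𝒪[F] b')).2 rfl
    rw [hbb] at h3
    set z := algebraMap F E ((residueLift (IsLocalRing.residue 𝒪[F] b') : F) / ϖ ^ (n + 1)) * s
      with hz
    have hσz : σ z = -z := by rw [hz, map_mul, AlgEquiv.commutes, hσs]; ring
    have e : mat σ ((cosetRep σ hσs hϖ0 n (some (IsLocalRing.residue 𝒪[F] b')))⁻¹ * k) 0 2 =
        (algebraMap F E a - (z - algebraMap F E b * s)) * mat σ k 2 2 := by
      rw [mat_mul_apply, mat_inv_apply, mat_inv_apply, mat_inv_apply]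
      simp only [cosetRep, upperElt, mat_ofMat, Fin.rev, ← hz]
      rw [div_eq_iff hk0] at hab
      simp [hσz]
      linear_combination hab
    rw [e, normAbs_mul, h, mul_one]
    exact normAbs_sub_le (ha.trans (one_le_pow₀ one_lt_residueCard_real.le)) h3

end Cosets

/-! ### The averaging integral as a finite sum -/

theorem setIntegral_iUnion_translates {G : Type*} [Group G] [MeasurableSpace G] [MeasurableMul G]
    (ν : Measure G) [ν.IsMulLeftInvariant] {ι : Type*} [Fintype ι] (r : ι → G) {S H : Set G}
    (hH : MeasurableSet H) (hfin : ν H ≠ ⊤)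
    (hS : S = ⋃ i, (fun x => (r i)⁻¹ * x) ⁻¹' H)
    (hdisj : Pairwise (Function.onFun Disjoint fun i => (fun x => (r i)⁻¹ * x) ⁻¹' H))
    {f : G → ℂ} (hf : ∀ i, ∀ h ∈ H, f (r i * h) = f (r i)) :
    ∫ x in S, f x ∂ν = (ν.real H : ℂ) * ∑ i, f (r i) := by
  have hm (i : ι) : MeasurableSet ((fun x => (r i)⁻¹ * x) ⁻¹' H) :=
    measurable_const_mul _ hH
  have hc (i : ι) : Set.EqOn f (fun _ => f (r i)) ((fun x => (r i)⁻¹ * x) ⁻¹' H) := by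
    intro x hx
    simpa using hf i _ hx
  have hν (i : ι) : ν ((fun x => (r i)⁻¹ * x) ⁻¹' H) = ν H := measure_preimage_mul ν _ H
  rw [hS, integral_iUnion_fintype hm hdisj, Finset.mul_sum]
  · refine Finset.sum_congr rfl fun i _ => ?_
    rw [setIntegral_congr_fun (hm i) (hc i), setIntegral_const, measureReal_def, hν,
      Complex.real_smul, measureReal_def]
  · intro i
    exact (integrableOn_const (by rw [hν]; exact hfin)).congr_fun (hc i).symm (hm i)

section

variable {F E : Type*}
    [Field F] [ValuativeRel F] [TopologicalSpace F] [IsNonarchimedeanLocalField F]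
    [Field E] [ValuativeRel E] [TopologicalSpace E] [IsNonarchimedeanLocalField E]
    [Algebra F E] [ValuativeExtension F E] (σ : E ≃ₐ[F] E)
    {μ₁ : Eˣ →ₜ* ℂˣ} {μ₂ : E1 σ →ₜ* ℂˣ}

omit [ValuativeRel F] [TopologicalSpace F] [IsNonarchimedeanLocalField F]
  [ValuativeExtension F E] in
-- Translate the integration variable by `k⁻¹`: Haar measure and the domain `K_{n+1}` are both
-- invariant.
theorem theta_mul_of_mem_K (hσn : ∀ x, normAbs E (σ x) = normAbs E x)
    (ν : Measure (G σ)) [ν.IsHaarMeasure] (n : ℕ) (f : indSpace σ μ₁ μ₂) (g : G σ) {k : G σ}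
    (hk : k ∈ K σ (n + 1)) : theta σ μ₁ μ₂ ν n f (g * k) = theta σ μ₁ μ₂ ν n f g := by
  have hm : MeasurableSet (K σ (n + 1)) := (isOpen_K σ _).measurableSet
  rw [theta, theta, ← integral_indicator hm, ← integral_indicator hm,
    ← integral_mul_left_eq_self _ k⁻¹]
  congr 2
  funext x
  have hiff : k⁻¹ * x ∈ K σ (n + 1) ↔ x ∈ K σ (n + 1) :=
    (KSubgroup σ hσn (n + 1)).mul_mem_cancel_left (inv_mem_K σ hσn hk)
  by_cases hx : x ∈ K σ (n + 1)
  · rw [Set.indicator_of_mem hx, Set.indicator_of_mem (hiff.2 hx)]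
    change f.1 (g * k * (k⁻¹ * x)) = f.1 (g * x)
    rw [mul_assoc, mul_inv_cancel_left]
  · rw [Set.indicator_of_notMem hx, Set.indicator_of_notMem (fun h => hx (hiff.1 h))]

variable {s : E} (hσs : σ s = -s) {ϖ : F} (hϖ0 : ϖ ≠ 0)
  (hϖ : normAbs E (algebraMap F E ϖ) = (residueCard E : ℝ)⁻¹)
  (hσn : ∀ x, normAbs E (σ x) = normAbs E x)

include hϖ hσn in
theorem theta_eq_sum [Fintype 𝓀[F]] (hs : normAbs E s = 1)
    (hmax : ∀ a b : F, normAbs E (algebraMap F E a + algebraMap F E b * s) =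
      max (normAbs E (algebraMap F E a)) (normAbs E (algebraMap F E b)))
    (hspan : ∀ x : E, ∃ a b : F, x = algebraMap F E a + algebraMap F E b * s)
    (h2 : normAbs E 2 = 1)
    (ν : Measure (G σ)) [ν.IsHaarMeasure] {n : ℕ} {f : indSpace σ μ₁ μ₂}
    (hf : f ∈ fixedVectors (ind σ μ₁ μ₂) n) (g : G σ) :
    theta σ μ₁ μ₂ ν n f g = ∑ o, f.1 (g * cosetRep σ hσs hϖ0 n o) := by
  have hopen : IsOpen (K σ (n + 1) ∩ K σ n) := (isOpen_K σ _).inter (isOpen_K σ _)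
  have hfin : ν (K σ (n + 1) ∩ K σ n) ≠ ⊤ :=
    ((measure_mono Set.inter_subset_left).trans_lt (isCompact_K σ hσn (n + 1)).measure_lt_top).ne
  have hpos : ν.real (K σ (n + 1) ∩ K σ n) ≠ 0 := by
    rw [measureReal_def, ENNReal.toReal_ne_zero]
    exact ⟨(hopen.measure_pos ν ⟨1, one_mem_K σ hσn _, one_mem_K σ hσn _⟩).ne', hfin⟩
  have hrep := cosetRep_mem_K σ hσs hϖ0 hϖ hs n
  rw [theta, setIntegral_iUnion_translates ν (cosetRep σ hσs hϖ0 n) hopen.measurableSet hfin,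
    inv_mul_cancel_left₀ (by exact_mod_cast hpos)]
  · rfl
  · ext k
    rw [Set.mem_iUnion]
    constructor
    · intro hk
      obtain ⟨o, ho⟩ := exists_cosetRep_inv_mul_mem σ hσs hϖ0 hϖ hσn hs hmax hspan h2 n hk
      exact ⟨o, mul_mem_K σ (inv_mem_K σ hσn (hrep o)) hk, ho⟩
    · rintro ⟨o, ho⟩
      have := mul_mem_K σ (hrep o) ho.1
      rwa [mul_inv_cancel_left] at this
  · intro o o' hne
    refine Set.disjoint_left.2 fun k hk hk' => hne ?_
    refine eq_of_cosetRep_inv_mul_mem σ hσs hϖ0 hϖ hσn hs n ?_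
    have := mul_mem_K σ hk.2 (inv_mem_K σ hσn hk'.2)
    rwa [mul_inv_rev, inv_inv, mul_assoc, mul_inv_cancel_left] at this
  · intro o h hh
    change f.1 (g * (cosetRep σ hσs hϖ0 n o * h)) = f.1 (g * cosetRep σ hσs hϖ0 n o)
    rw [← mul_assoc, apply_mul_of_mem_K σ μ₁ μ₂ hf _ hh.2]

omit [ValuativeExtension F E] in
include hϖ in
theorem sum_apply_cosetRep [Fintype 𝓀[F]] (hσσ : ∀ x, σ (σ x) = x) {n : ℕ} {f : indSpace σ μ₁ μ₂}
    (hf : f ∈ fixedVectors (ind σ μ₁ μ₂) n) :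
    ∑ o, f.1 (cosetRep σ hσs hϖ0 n o) =
      ((residueCard E : ℂ) * (μ₁ (Units.map (algebraMap F E) (Units.mk0 ϖ hϖ0)) : ℂ)⁻¹ +
        residueCard F) * f.1 1 := by
  have hϖE : algebraMap F E ϖ ≠ 0 := by simpa using hϖ0
  rw [Fintype.sum_option, add_mul]
  congr 1
  · have hb : diagElt σ hσσ (algebraMap F E ϖ) hϖE ∈ B σ :=
      (mem_B_of_last_row σ (t := algebraMap F E ϖ) (by simp [diagElt]) (by simp [diagElt])
        (by simp [diagElt])).1
    have hw := antidiagElt_mem_K σ (n := n) (a := algebraMap F E (ϖ ^ n)) (by simp [hϖ0])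
      (AlgEquiv.commutes σ _) (by simp [hϖ])
    -- Splitting off `diag(ϖ⁻¹, 1, ϖ)` leaves the antidiagonal element of `K_n`. The diagonal part
    -- contributes `|ϖ⁻¹|_E μ₁(ϖ)⁻¹`.
    have e : cosetRep σ hσs hϖ0 n none =
        ((⟨_, hb⟩ : B σ) : G σ) * antidiagElt σ (algebraMap F E (ϖ ^ n)) (by simp [hϖ0])
          (AlgEquiv.commutes σ _) := by
      apply mat_injective
      ext i j
      rw [mat_mul_apply]
      fin_cases i <;> fin_cases j <;>
        simp [cosetRep, antidiagElt, diagElt, pow_succ, mul_comm]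
    have hA : entryA σ ⟨_, hb⟩ = (Units.map (algebraMap F E) (Units.mk0 ϖ hϖ0))⁻¹ := by
      ext
      change mat σ (diagElt σ hσσ (algebraMap F E ϖ) hϖE) 0 0 = _
      simp [diagElt]
    have hB : entryB σ ⟨_, hb⟩ = 1 := by
      ext
      change mat σ (diagElt σ hσσ (algebraMap F E ϖ) hϖE) 1 1 = _
      simp [diagElt]
    have hn : normAbs E ((entryA σ ⟨_, hb⟩ : Eˣ) : E) = residueCard E := by
      rw [hA]
      simp [hϖ]
    have h1 := apply_mul_of_mem_K σ μ₁ μ₂ hf 1 hw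
    rw [one_mul] at h1
    rw [e, apply_B_mul, h1, weight_eq, hn, hA, hB]
    simp
  · have h (r : 𝓀[F]) : f.1 (cosetRep σ hσs hϖ0 n (some r)) = f.1 1 := by
      have hb : cosetRep σ hσs hϖ0 n (some r) ∈ B σ :=
        (mem_B_of_last_row σ (t := 1) (by simp [cosetRep, upperElt]) (by simp [cosetRep, upperElt])
          (by simp [cosetRep, upperElt])).1
      have hA : entryA σ ⟨_, hb⟩ = 1 := by
        ext
        change mat σ (cosetRep σ hσs hϖ0 n (some r)) 0 0 = _
        simp [cosetRep, upperElt]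
      have hB : entryB σ ⟨_, hb⟩ = 1 := by
        ext
        change mat σ (cosetRep σ hσs hϖ0 n (some r)) 1 1 = _
        simp [cosetRep, upperElt]
      have h1 := apply_B_mul σ μ₁ μ₂ f ⟨_, hb⟩ 1
      rw [mul_one, weight_eq, hA, hB] at h1
      simpa using h1
    simp [h, residueCard, Nat.card_eq_fintype_card]

end

/-! ### The exceptional character -/

section

variable {F E : Type*}
    [Field F] [ValuativeRel F] [TopologicalSpace F] [IsNonarchimedeanLocalField F] [CharZero F]
    [Field E] [ValuativeRel E] [TopologicalSpace E] [IsNonarchimedeanLocalField E]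
    [Algebra F E] [ValuativeExtension F E] {ε : F} {s : E}

/-- The exceptional condition on an unramified quasi-character in terms of a uniformizer. -/
theorem restrict_eq_omega_iff (hF : ringChar 𝓀[F] ≠ 2) (hε : valuation F ε = 1)
    (hsq : ¬ IsSquare ε) (hs : s ^ 2 = algebraMap F E ε) (hadj : Algebra.adjoin F {s} = ⊤)
    {σ : E ≃ₐ[F] E} (hσ : σ ≠ 1) {μ₁ : Eˣ →ₜ* ℂˣ} (hμ₁ : IsUnramifiedChar μ₁)
    {ϖ : F} (hϖ0 : ϖ ≠ 0) (hϖ : normAbs F ϖ = (residueCard F : ℝ)⁻¹) :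
    ((fun x : Fˣ => (μ₁ (Units.map (algebraMap F E) x) : ℂ)) =
      fun x : Fˣ => omegaEF F E x * (normAbs F (x : F) : ℂ)⁻¹) ↔
    (residueCard E : ℂ) * (μ₁ (Units.map (algebraMap F E) (Units.mk0 ϖ hϖ0)) : ℂ)⁻¹ +
        residueCard F = 0 := by
  have hq : (0 : ℝ) < residueCard F := residueCard_pos
  have hqC : (residueCard F : ℂ) ≠ 0 := by exact_mod_cast hq.ne'
  set c : ℂˣ := μ₁ (Units.map (algebraMap F E) (Units.mk0 ϖ hϖ0)) with hc
  have hc0 : (c : ℂ) ≠ 0 := c.ne_zero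
  have hiff : (residueCard E : ℂ) * (c : ℂ)⁻¹ + residueCard F = 0 ↔
      (c : ℂ) = -(residueCard F : ℂ) := by
    rw [residueCard_eq_sq hF hε hsq hs hadj]
    push_cast
    have e : (residueCard F : ℂ) ^ 2 * (c : ℂ)⁻¹ + residueCard F =
        residueCard F * (c : ℂ)⁻¹ * (c + residueCard F) := by
      field_simp
      ring
    rw [e, mul_eq_zero, or_iff_right (mul_ne_zero hqC (inv_ne_zero hc0)),
      add_eq_zero_iff_eq_neg]
  rw [hiff]
  constructor
  · intro h
    have h1 := congrFun h (Units.mk0 ϖ hϖ0)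
    simp only [← hc] at h1
    rw [h1, omegaEF_eq (k := -1) hF hε hsq hs hadj hσ (by simpa using hϖ)]
    simp [hϖ]
  · intro h
    funext x
    obtain ⟨k, hk⟩ := exists_normAbs_eq_zpow x.ne_zero
    -- As `|x| = q ^ k`, the element `x ϖ ^ k` is a unit. An unramified `μ₁` is thus determined on
    -- `Fˣ` by its value at `ϖ`.
    have hu : μ₁ (Units.map (algebraMap F E) (x * Units.mk0 ϖ hϖ0 ^ k)) = 1 := by
      refine hμ₁ _ ?_
      rw [Units.coe_map]
      change normAbs E (algebraMap F E _) = 1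
      rw [normAbs_algebraMap_eq_one_iff]
      simp [hk, hϖ, (zpow_pos hq k).ne']
    rw [map_mul, map_mul, map_zpow, map_zpow, ← hc] at hu
    have h3 : (μ₁ (Units.map (algebraMap F E) x) : ℂ) * (c : ℂ) ^ k = 1 := by
      have := congrArg Units.val hu
      rwa [Units.val_mul, Units.val_zpow_eq_zpow_val, Units.val_one] at this
    rw [omegaEF_eq hF hε hsq hs hadj hσ hk, hk, eq_inv_of_mul_eq_one_left h3, h, neg_eq_neg_one_mul,
      mul_zpow, mul_inv, ← inv_zpow, inv_neg, inv_one]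
    push_cast
    rfl

end

end U21

end

/-! ### The main theorem -/

theorem lemma3p2 {F E : Type*}
    [Field F] [ValuativeRel F] [TopologicalSpace F] [IsNonarchimedeanLocalField F] [CharZero F]
    (hF : ringChar 𝓀[F] ≠ 2)
    [Field E] [ValuativeRel E] [TopologicalSpace E] [IsNonarchimedeanLocalField E]
    [Algebra F E] [ValuativeExtension F E] (hE : U21.IsUnramifiedQuadratic F E)
    (σ : E ≃ₐ[F] E) (hσ : σ ≠ 1)
    (ν : MeasureTheory.Measure (U21.G σ)) [ν.IsHaarMeasure]
    (μ₁ : Eˣ →ₜ* ℂˣ) (hμ₁ : U21.IsUnramifiedChar μ₁) (μ₂ : U21.E1 σ →ₜ* ℂˣ) :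
    let π := U21.ind σ μ₁ μ₂
    let N := U21.conductor π
    (∃ n, U21.fixedVectors π n ≠ ⊥) ∧
    ∃ θ' : U21.fixedVectors π N →ₗ[ℂ] U21.fixedVectors π (N + 1),
      (∀ (f : U21.fixedVectors π N) (g : U21.G σ),
        (θ' f : U21.indSpace σ μ₁ μ₂).1 g = U21.theta σ μ₁ μ₂ ν N f g) ∧
      (Function.Injective θ' ↔
        (fun x : Fˣ => (μ₁ (Units.map (algebraMap F E) x) : ℂ)) ≠
          fun x : Fˣ => U21.omegaEF F E x * (U21.normAbs F (x : F) : ℂ)⁻¹) := by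
  intro π N
  obtain ⟨ε, s, hε, hsq, hs, hadj⟩ := hE
  have hσs := U21.map_generator_eq_neg hs hadj hσ
  have hσσ := U21.map_map_of_quadratic hs hadj hσ
  have hσn := U21.normAbs_galois hF hε hsq hs hadj hσ
  have hspan := U21.exists_eq_add_mul hs hadj
  have hmax := U21.normAbs_add_mul_generator hF hε hsq hs
  have hsn := U21.normAbs_generator hε hs
  have hs1 : U21.normAbs E (1 + s) = 1 := by
    have := U21.normAbs_algebraMap_add_generator hF hε hsq hs (a := 1) U21.normAbs_one.le
    rwa [map_one] at this
  have h2 : U21.normAbs E 2 = 1 := by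
    rw [← map_ofNat (algebraMap F E) 2, U21.normAbs_algebraMap_eq_one_iff]
    exact U21.normAbs_two hF
  obtain ⟨ϖ, hϖF⟩ := U21.exists_normAbs_eq_inv F
  have hϖ := U21.normAbs_algebraMap_uniformizer hF hε hsq hs hadj hϖF
  have hϖ0 : ϖ ≠ 0 := by
    rintro rfl
    rw [U21.normAbs_zero] at hϖF
    exact (inv_pos.2 U21.residueCard_pos).ne hϖF
  have := Fintype.ofFinite 𝓀[F]
  have hex : ∃ n, U21.fixedVectors π n ≠ ⊥ :=
    (U21.exists_level σ μ₂).imp fun n hn => U21.fixedVectors_ne_bot σ hσn hμ₁ hn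
  have hN : U21.fixedVectors π N ≠ ⊥ := Nat.sInf_mem hex
  have hzero {n : ℕ} (hn : n ≤ N + 1) {f : U21.indSpace σ μ₁ μ₂}
      (hf : f ∈ U21.fixedVectors π n) (h : f.1 1 = 0) : f = 0 :=
    U21.eq_zero_of_apply_one_eq_zero σ hσσ hσn h2 hμ₁ hϖ (AlgEquiv.commutes σ ϖ) hσs hsn hs1 hn hf h
  -- Defining the operator as a sum of translations makes linearity and smoothness of the image
  -- automatic. It agrees with the integral only on `V(N)`.
  let L : U21.indSpace σ μ₁ μ₂ →ₗ[ℂ] U21.indSpace σ μ₁ μ₂ :=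
    ∑ o, π (U21.cosetRep σ hσs hϖ0 N o)
  have hL (f : U21.indSpace σ μ₁ μ₂) (g : U21.G σ) :
      (L f).1 g = ∑ o, f.1 (g * U21.cosetRep σ hσs hϖ0 N o) := by
    simp only [L, LinearMap.sum_apply]
    rw [AddSubmonoidClass.coe_finsetSum, Finset.sum_apply]
    rfl
  have hLθ (f : U21.indSpace σ μ₁ μ₂) (hf : f ∈ U21.fixedVectors π N) (g : U21.G σ) :
      (L f).1 g = U21.theta σ μ₁ μ₂ ν N f g := by
    rw [hL, U21.theta_eq_sum σ hσs hϖ0 hϖ hσn hsn hmax hspan h2 ν hf]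
  have hLmem (f : U21.fixedVectors π N) :
      (L ∘ₗ (U21.fixedVectors π N).subtype) f ∈ U21.fixedVectors π (N + 1) := by
    intro k hk
    refine Subtype.ext (funext fun g => ?_)
    change (L f).1 (g * k) = (L f).1 g
    rw [hLθ f f.2, hLθ f f.2, U21.theta_mul_of_mem_K σ hσn ν N f.1 g hk]
  have hL1 (f : U21.fixedVectors π N) : (L f).1 1 =
      ((U21.residueCard E : ℂ) * (μ₁ (Units.map (algebraMap F E) (Units.mk0 ϖ hϖ0)) : ℂ)⁻¹ +
        U21.residueCard F) * (f : U21.indSpace σ μ₁ μ₂).1 1 := by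
    rw [hL, ← U21.sum_apply_cosetRep σ hσs hϖ0 hϖ hσσ f.2]
    simp only [one_mul]
  refine ⟨hex, (L ∘ₗ (U21.fixedVectors π N).subtype).codRestrict _ hLmem,
    fun f g => hLθ f f.2 g, ?_⟩
  rw [Ne, U21.restrict_eq_omega_iff hF hε hsq hs hadj hσ hμ₁ hϖ0 hϖF, injective_iff_map_eq_zero]
  constructor
  · intro hinj h0
    refine hN ((Submodule.eq_bot_iff _).2 fun f hf => ?_)
    -- If the factor vanishes, the image in `V(N + 1)` vanishes at the identity, hence everywhere.
    -- Thus the level `N + 1` is needed in `hzero`, and injectivity would give `V(N) = 0`.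
    have hLf : L f = 0 := hzero le_rfl (hLmem ⟨f, hf⟩) (by
      rw [hL1 ⟨f, hf⟩, h0, zero_mul])
    exact congrArg Subtype.val (hinj ⟨f, hf⟩ (Subtype.ext hLf))
  · intro h0 f hf
    have hLf : L f = 0 := congrArg Subtype.val hf
    have h1 := hL1 f
    rw [hLf] at h1
    exact Subtype.ext (hzero N.le_succ f.2
      ((mul_eq_zero.1 h1.symm).resolve_left h0))
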